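/- Call the expansion of a graph $G=(V,E)$ with $|V|\ge 2$ the minimum of $|N(S)|/|S|$ over all nonempty $S\subseteq V$ with $|S|\le |V|/2$, where $N(S)$ is the set of vertices outside $S$ that have a neighbour in $S$. For a graph $G$ on a set $X$ of Boolean variables let $\mathsf{IP}_G(X)=\bigoplus_{xy\in E}x\cdot y$. For a PCNF formula $\Phi=Q_1x_1\ldots Q_kx_k.\,C_1\land\dots\land C_m$ (the $x_i$ distinct and exactly the variables of the clauses) and an ordering $\pi$ of its variables, a $\pi$-OBDD-refutation of $\Phi$ is a sequence $L_1,\dots,L_\ell$, $\ell\ge m$, of OBDDs with variable order $\pi$ such that $L_i$ represents $C_i$ for $1\le i\le m$, $L_\ell$ represents the constant $0$, and every $L_i$ with $i>m$ is obtained from earlier lines by one of the following rules: conjunction ($L_i$ represents $L_j\land L_{j'}$), projection ($L_i$ represents $\exists x.L_j$ for a variable $x$ of $L_j$), semantic entailment ($L_i$ is entailed by a set of earlier lines), and universal reduction ($L_i$ represents $L_j[u/c]$, where $c\in\{0,1\}$ and $u$ is a universal variable that is rightmost, in the order of the quantifiers, among the variables of $L_j$). Its size is the total number of nodes of the OBDDs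 $L_1,\dots,L_\ell$. An OBDD-refutation is a $\pi$-OBDD-refutation for an arbitrary $\pi$. A PCNF formula is false if it has a universal winning strategy. The Tseitin encoding of a Boolean circuit is the CNF with one variable per input and per gate, whose clauses say that every gate has the value computed from its arguments. Theorem. There are constants $\Delta,K\in\mathbb{N}$ and $d,c>0$ such that for every $n\ge 2$ there are 1. a graph $G_n$ with $n$ vertices $X_n$, maximum degree at most $\Delta$ and expansion at least $d$; 2. a Boolean circuit $C_n$ (over fan-in two $\land$, $\lor$, and $\neg$) with inputs $X_n$ and at most $Kn$ gates that computes $\neg\mathsf{IP}_{G_n}(X_n)$; and 3. the PCNF formula $\Phi_n=\exists X_n\,\forall z\,\exists Y.\,\varphi_n$, where $\varphi_n$ is the Tseitin encoding of $C_n$, $z$ is the variable of the output gate of $C_n$, and $Y$ are the variables of its other gates, such that $\Phi_n$ is false, $|\Phi_n|\le Kn$, and, for every ordering $\pi$ of the variables of $\Phi_n$, every $\pi$-OBDD-refutation of $\Phi_n$ has size at least $2^{cn}$. -/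

import Mathlib

/-! ### Graphs: expansion, and the inner product function of a graph -/

/-- The open neighbourhood of `S`: the vertices outside `S` that have a neighbour in `S`. -/
def openNeighborhood {V : Type} (G : SimpleGraph V) (S : Set V) : Set V :=
  {v | v ∉ S ∧ ∃ u ∈ S, G.Adj u v}

/-- The (vertex) expansion of `G`, i.e. the minimum of `|N(S)| / |S|` over all nonempty
`S ⊆ V` with `|S| ≤ |V| / 2`.  For `|V| ≥ 2` this is the infimum of a finite nonempty set. -/
noncomputable def expansion {V : Type} [Fintype V] (G : SimpleGraph V) : ℝ :=
  sInf {r : ℝ | ∃ S : Set V, S.Nonempty ∧ (S.ncard : ℝ) ≤ (Fintype.card V : ℝ) / 2 ∧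
    r = ((openNeighborhood G S).ncard : ℝ) / (S.ncard : ℝ)}

open Classical in
/-- `IP_G(x) = ⨁_{uv ∈ E} x_u · x_v`, computed in the field with two elements. -/
noncomputable def innerProduct {V : Type} [Fintype V] (G : SimpleGraph V) (x : V → Bool) : Bool :=
  decide ((∑ e ∈ G.edgeFinset, (e.map (fun v => if x v then (1 : ZMod 2) else 0)).mul) = 1)

/-! ### CNF formulas and quantified Boolean formulas -/

/-- The literal `var` (if `pos = true`) or `¬ var` (if `pos = false`). -/
structure Literal (V : Type) where
  var : V
  pos : Bool

def Literal.eval {V : Type} (a : V → Bool) (l : Literal V) : Bool :=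
  if l.pos then a l.var else !(a l.var)

/-- A clause is a disjunction of literals. -/
abbrev Clause (V : Type) := List (Literal V)

def Clause.eval {V : Type} (a : V → Bool) (C : Clause V) : Bool :=
  C.any (Literal.eval a)

/-- A CNF formula is a conjunction of clauses. -/
abbrev CNFormula (V : Type) := List (Clause V)

def CNFormula.eval {V : Type} (a : V → Bool) (φ : CNFormula V) : Bool :=
  φ.all (Clause.eval a)

inductive Quantifier where
  | all
  | ex
  deriving DecidableEq

/-- A PCNF formula `Q₁x₁ … Qₙxₙ. φ` with `φ` in CNF, pairwise distinct `xᵢ`, and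
`{x₁, …, xₙ} = var(φ)`. -/
structure PCNF (V : Type) where
  quants : List (Quantifier × V)
  matrix : CNFormula V
  nodup : (quants.map Prod.snd).Nodup
  closed : ∀ v, v ∈ quants.map Prod.snd ↔ ∃ C ∈ matrix, ∃ l ∈ C, l.var = v

namespace PCNF

variable {V : Type}

def IsUniversal (Φ : PCNF V) (u : V) : Prop := (Quantifier.all, u) ∈ Φ.quants

/-- `x` is left of `y` in the sequence of quantified variables. -/
def LeftOf (Φ : PCNF V) (x y : V) : Prop := [x, y].Sublist (Φ.quants.map Prod.snd)

/-- A universal strategy: `f u` depends only on the variables left of `u`, for universal `u`. -/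
def IsStrategy (Φ : PCNF V) (f : V → (V → Bool) → Bool) : Prop :=
  ∀ u, Φ.IsUniversal u → ∀ τ σ : V → Bool, (∀ x, Φ.LeftOf x u → τ x = σ x) → f u τ = f u σ

/-- A universal winning strategy.  The assignments `ρ` with `ρ u = f u ρ` for all universal `u` are
exactly the assignments `τ ∪ f(τ)`, where `τ` is an assignment of the existential variables. -/
def IsWinningStrategy (Φ : PCNF V) (f : V → (V → Bool) → Bool) : Prop :=
  Φ.IsStrategy f ∧
    ∀ ρ : V → Bool, (∀ u, Φ.IsUniversal u → ρ u = f u ρ) → Φ.matrix.eval ρ = false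

/-- A QBF is false if it has a universal winning strategy. -/
def IsFalse (Φ : PCNF V) : Prop := ∃ f, Φ.IsWinningStrategy f

/-- The size: one for each quantified variable, each clause, and each occurrence of a literal. -/
def size (Φ : PCNF V) : ℕ :=
  Φ.quants.length + (Φ.matrix.map (fun C => C.length + 1)).sum

end PCNF

/-! ### Boolean circuits and the Tseitin transformation -/

/-- A gate whose arguments are taken from `α`. -/
inductive Gate (α : Type) where
  | and (a b : α)
  | or (a b : α)
  | not (a : α)

def Gate.eval {α : Type} (v : α → Bool) : Gate α → Bool
  | .and a b => v a && v b
  | .or a b => v a || v b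
  | .not a => !(v a)

/-- A Boolean circuit with inputs `ι` and gates `0, …, size - 1`, numbered topologically: the
arguments of gate `g` are inputs or gates with a smaller number.  One gate is the output. -/
structure Circuit (ι : Type) where
  size : ℕ
  gate : (g : Fin size) → Gate (ι ⊕ Fin g.val)
  output : Fin size

namespace Circuit

variable {ι : Type}

/-- The value of gate `g` on input `x`. -/
def gateValue (C : Circuit ι) (x : ι → Bool) (g : Fin C.size) : Bool :=
  (C.gate g).eval (Sum.elim x (fun h => C.gateValue x ⟨h.val, h.isLt.trans g.isLt⟩))
termination_by g.val
decreasing_by exact h.isLt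

def eval (C : Circuit ι) (x : ι → Bool) : Bool := C.gateValue x C.output

/-- The propositional variables of the Tseitin transformation: one for every input and one for
every gate. -/
abbrev Var (C : Circuit ι) : Type := ι ⊕ Fin C.size

/-- The variable of an argument of gate `g`. -/
def argVar (C : Circuit ι) (g : Fin C.size) : ι ⊕ Fin g.val → C.Var :=
  Sum.map id (fun h => ⟨h.val, h.isLt.trans g.isLt⟩)

/-- The clauses stating that the variable of gate `g` has the value computed by that gate from
its arguments. -/
def gateClauses (C : Circuit ι) (g : Fin C.size) : CNFormula C.Var :=
  let y : C.Var := Sum.inr g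
  match C.gate g with
  | .and a b =>
      [[⟨y, false⟩, ⟨C.argVar g a, true⟩],
       [⟨y, false⟩, ⟨C.argVar g b, true⟩],
       [⟨y, true⟩, ⟨C.argVar g a, false⟩, ⟨C.argVar g b, false⟩]]
  | .or a b =>
      [[⟨y, true⟩, ⟨C.argVar g a, false⟩],
       [⟨y, true⟩, ⟨C.argVar g b, false⟩],
       [⟨y, false⟩, ⟨C.argVar g a, true⟩, ⟨C.argVar g b, true⟩]]
  | .not a =>
      [[⟨y, true⟩, ⟨C.argVar g a, true⟩],
       [⟨y, false⟩, ⟨C.argVar g a, false⟩]]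

/-- The Tseitin transformation of `C`: a CNF formula whose satisfying assignments are exactly the
values of all inputs and gates of `C` on the assignments of the inputs. -/
def tseitin (C : Circuit ι) : CNFormula C.Var :=
  (List.finRange C.size).flatMap C.gateClauses

/-- The quantifiers `∃ X ∀ z ∃ Y` for a circuit with `n` inputs: `X` are the inputs, `z` is the
variable of the output gate, and `Y` are the variables of the other gates. -/
def existsForallExists {n : ℕ} (C : Circuit (Fin n)) : List (Quantifier × C.Var) :=
  (List.finRange n).map (fun i => (Quantifier.ex, Sum.inl i)) ++
    (Quantifier.all, Sum.inr C.output) ::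
      ((List.finRange C.size).filter (fun g => g ≠ C.output)).map
        (fun g => (Quantifier.ex, Sum.inr g))

end Circuit

/-! ### OBDDs -/

/-- An ordering of a finite set of variables, given by the position of each variable. -/
abbrev VarOrder (V : Type) [Fintype V] := V ≃ Fin (Fintype.card V)

/-- A `π`-OBDD.  Its nodes are the inner nodes `Fin inner` and the two sinks labelled by `Bool`.
Every inner node is labelled with a variable and has a `0`-edge and a `1`-edge; along edges
the variables strictly increase in the order `π` (so the graph is acyclic), and no inner node other
than the root is a source. -/
structure OBDD (V : Type) [Fintype V] (π : VarOrder V) where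
  inner : ℕ
  label : Fin inner → V
  child : Fin inner → Bool → Fin inner ⊕ Bool
  root : Fin inner ⊕ Bool
  ordered : ∀ i b j, child i b = Sum.inl j → π (label i) < π (label j)
  source : ∀ i, root ≠ Sum.inl i → ∃ j b, child j b = Sum.inl i

namespace OBDD

variable {V : Type} [Fintype V] {π : VarOrder V}

/-- The number of nodes, including the two sinks. -/
def size (B : OBDD V π) : ℕ := B.inner + 2

/-- The variables that occur as labels of nodes. -/
def vars (B : OBDD V π) : Set V := Set.range B.label

/-- One step on the path of the assignment `a`; the path stays at a sink. -/
def step (B : OBDD V π) (a : V → Bool) : Fin B.inner ⊕ Bool → Fin B.inner ⊕ Bool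
  | .inl i => B.child i (a (B.label i))
  | .inr b => .inr b

/-- The node reached from the root on the path of `a` after as many steps as there are inner nodes.
It is a sink, see `exists_endpoint_eq`. -/
def endpoint (B : OBDD V π) (a : V → Bool) : Fin B.inner ⊕ Bool :=
  (B.step a)^[B.inner] B.root

/-- The path of every assignment ends in a sink. -/
theorem exists_endpoint_eq (B : OBDD V π) (a : V → Bool) : ∃ b, B.endpoint a = Sum.inr b := by
  set f : Fin B.inner → ℕ := fun i =>
    (Finset.univ.filter (fun j => π (B.label i) ≤ π (B.label j))).card with hf
  have hdec : ∀ i b j, B.child i b = Sum.inl j → f j < f i := by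
    intro i b j h
    have hlt := B.ordered i b j h
    refine Finset.card_lt_card ⟨fun k hk => ?_, fun hsub => ?_⟩
    · simp only [Finset.mem_filter, Finset.mem_univ, true_and] at hk ⊢
      exact hlt.le.trans hk
    · have hi := @hsub i (by simp)
      simp only [Finset.mem_filter, Finset.mem_univ, true_and] at hi
      exact absurd hlt (not_lt.mpr hi)
  have hpos : ∀ i, 0 < f i := fun i => Finset.card_pos.mpr ⟨i, by simp⟩
  have hle : ∀ i, f i ≤ B.inner := fun i => by
    simpa [hf] using Finset.card_filter_le (Finset.univ : Finset (Fin B.inner)) _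
  have key : ∀ m j, (B.step a)^[m] B.root = Sum.inl j → f j + m ≤ B.inner := by
    intro m
    induction m with
    | zero => intro j _; simpa using hle j
    | succ m ih =>
      intro j h
      rw [Function.iterate_succ_apply'] at h
      cases hm : (B.step a)^[m] B.root with
      | inl i =>
        rw [hm] at h
        have h1 := hdec i _ j h
        have h2 := ih i hm
        omega
      | inr b => rw [hm] at h; cases h
  cases h : B.endpoint a with
  | inl j =>
    have h1 := key _ j h
    have h2 := hpos j
    omega
  | inr b => exact ⟨b, rfl⟩

/-- The value computed on `a`: the label of the sink that the path of `a` reaches. -/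
def eval (B : OBDD V π) (a : V → Bool) : Bool :=
  match B.endpoint a with
  | .inl _ => false
  | .inr b => b

/-- `B` computes the Boolean function `f`. -/
def Represents (B : OBDD V π) (f : (V → Bool) → Bool) : Prop := ∀ a, B.eval a = f a

end OBDD

/-! ### OBDD derivations and refutations -/

section Derivations

variable {V : Type} [Fintype V] [DecidableEq V] {π : VarOrder V}

/-- `B` follows from the list `prev` of the preceding lines by one of the rules. -/
inductive DerivedFrom (Φ : PCNF V) (prev : List (OBDD V π)) (B : OBDD V π) : Prop where
  /-- Conjunction. -/
  | conj (L L' : OBDD V π) (hL : L ∈ prev) (hL' : L' ∈ prev)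
      (h : B.Represents (fun a => L.eval a && L'.eval a))
  /-- Projection. -/
  | proj (L : OBDD V π) (hL : L ∈ prev) (x : V) (hx : x ∈ L.vars)
      (h : B.Represents (fun a =>
        L.eval (Function.update a x false) || L.eval (Function.update a x true)))
  /-- Semantic entailment. -/
  | entail (S : List (OBDD V π)) (hS : ∀ L ∈ S, L ∈ prev)
      (h : ∀ a, (∀ L ∈ S, L.eval a = true) → B.eval a = true)
  /-- Universal reduction. -/
  | forallRed (L : OBDD V π) (hL : L ∈ prev) (u : V) (c : Bool) (hu : Φ.IsUniversal u)
      (hmem : u ∈ L.vars) (hright : ∀ x ∈ L.vars, x = u ∨ Φ.LeftOf x u)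
      (h : B.Represents (fun a => L.eval (Function.update a u c)))

/-- A `π`-OBDD derivation from `Φ`: the first `m` lines represent the `m` clauses of the matrix, in
order, and every later line is derived from earlier lines. -/
def IsDerivation (Φ : PCNF V) (D : List (OBDD V π)) : Prop :=
  Φ.matrix.length ≤ D.length ∧
    ∀ i (hi : i < D.length),
      (∀ hm : i < Φ.matrix.length, D[i].Represents (fun a => Φ.matrix[i].eval a)) ∧
      (Φ.matrix.length ≤ i → DerivedFrom Φ (D.take i) D[i])

/-- A `π`-OBDD-refutation of `Φ`: a derivation whose last line represents `0`. -/
def IsRefutation (Φ : PCNF V) (D : List (OBDD V π)) : Prop :=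
  IsDerivation Φ D ∧ ∃ B ∈ D.getLast?, B.Represents (fun _ => false)

/-- The sum of the sizes of the OBDDs. -/
def derivationSize (D : List (OBDD V π)) : ℕ := (D.map OBDD.size).sum

end Derivations

/-! ### Expanders -/

/-! A short refutation yields a small decision list for `IP_G`, and expansion excludes such a list
for every variable order.

Strategy extraction: `z` is the only universal variable and only `X` is to its left, so a line
`L[z/c]` obtained by universal reduction depends on `X` alone. It is read as the instruction "if
this OBDD is 0, play `z = c`". All other rules are sound, so on every input the first instruction
that fires is a winning move, which is `z = IP_G(x)` (`IsRefutation.exists_decisionList`). The OBDDs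
of the list have total size at most the size `S` of the refutation.

Rectangles: cut `π` where half of `X` has been read. The zeros of an OBDD are a union of rectangles,
one for each node at which the path can cross the cut. Hence `IP_G` is given by a decision list of
at most `S` rectangles, and peeling them off one by one leaves a monochromatic rectangle of density
at least `1/(S+1)` on each side (`exists_monochromatic_rectangle`).

Rank: across the cut, `IP_G` is `q₁(a) + q₂(b) + aᵀMb`, where `M` is the cross block of the
adjacency matrix over the field with two elements. On a monochromatic `A × B` the differences of `A`
and of `B` are orthogonal with respect to `M`, so `|A| |B| ≤ 2^(n - rank M)` and therefore `2^(rank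
M) ≤ (S+1)²`. Expansion makes linearly many columns of `M` nonzero, whichever half is read first,
and bounded degree turns this into linear rank (`openNeighborhood_ncard_le_rank_mul`).

The expanders are unions of 20 permutations, found by a union bound. -/

theorem choose_mul_pow_le_choose_mul_pow {u n : ℕ} (h : u ≤ n) (s : ℕ) :
    u.choose s * n ^ s ≤ n.choose s * u ^ s := by
  induction s with
  | zero => simp
  | succ s ih =>
    -- This is `(u - s) / (n - s) ≤ u / n`, the bound for one factor of the quotient of the
    -- binomials.
    have h1 : (u - s) * n ≤ (n - s) * u := by
      rcases le_total u s with hs | hs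
      · simp [Nat.sub_eq_zero_of_le hs]
      · zify [hs, hs.trans h]
        nlinarith
    refine Nat.le_of_mul_le_mul_right (c := s + 1) ?_ s.succ_pos
    calc u.choose (s + 1) * n ^ (s + 1) * (s + 1)
        = (u.choose (s + 1) * (s + 1)) * n ^ (s + 1) := by ring
      _ = (u.choose s * n ^ s) * ((u - s) * n) := by rw [Nat.choose_succ_right_eq]; ring
      _ ≤ (n.choose s * u ^ s) * ((n - s) * u) := Nat.mul_le_mul ih h1
      _ = (n.choose (s + 1) * (s + 1)) * u ^ (s + 1) := by rw [Nat.choose_succ_right_eq]; ring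
      _ = n.choose (s + 1) * u ^ (s + 1) * (s + 1) := by ring

/-! ### Counting the permutations that map one set into another -/

section Permutations

variable {α : Type*} [Fintype α] [DecidableEq α]

theorem exists_perm_image_eq {T T' : Finset α} (h : T.card = T'.card) :
    ∃ τ : Equiv.Perm α, T.image τ = T' := by
  let e : {x // x ∈ T} ≃ {x // x ∈ T'} := Finset.equivOfCardEq h
  refine ⟨e.extendSubtype, Finset.eq_of_subset_of_card_le ?_ ?_⟩
  · intro y hy
    obtain ⟨x, hx, rfl⟩ := Finset.mem_image.mp hy
    exact e.extendSubtype_mem x hx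
  · rw [Finset.card_image_of_injective _ (Equiv.injective _), h]

/-- Composition with a permutation taking `T` to `T'` is a bijection between the two families. -/
theorem card_perm_image_eq_congr (S : Finset α) {T T' : Finset α} (h : T.card = T'.card) :
    (Finset.univ.filter (fun σ : Equiv.Perm α => S.image σ = T)).card =
      (Finset.univ.filter (fun σ : Equiv.Perm α => S.image σ = T')).card := by
  obtain ⟨τ, rfl⟩ := exists_perm_image_eq h
  refine Finset.card_bij (fun σ _ => τ * σ) ?_ ?_ ?_
  · intro σ hσ
    simp only [Finset.mem_filter, Finset.mem_univ, true_and] at hσ ⊢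
    rw [← hσ, Finset.image_image]
    rfl
  · intro a _ b _ hab
    exact mul_left_cancel hab
  · intro σ hσ
    simp only [Finset.mem_filter, Finset.mem_univ, true_and] at hσ
    refine ⟨τ⁻¹ * σ, ?_, by simp⟩
    simp only [Finset.mem_filter, Finset.mem_univ, true_and]
    have : S.image (τ⁻¹ * σ : Equiv.Perm α) = (S.image σ).image (τ⁻¹ : Equiv.Perm α) := by
      rw [Finset.image_image]; rfl
    rw [this, hσ, Finset.image_image]
    have hid : (⇑(τ⁻¹ : Equiv.Perm α) ∘ ⇑τ) = id := by ext x; simp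
    rw [hid, Finset.image_id]

theorem card_perm_image_subset_eq_sum (S U : Finset α) :
    (Finset.univ.filter (fun σ : Equiv.Perm α => S.image σ ⊆ U)).card =
      ∑ T ∈ U.powersetCard S.card,
        (Finset.univ.filter (fun σ : Equiv.Perm α => S.image σ = T)).card := by
  rw [Finset.card_eq_sum_card_fiberwise (f := fun σ : Equiv.Perm α => S.image σ)
    (t := U.powersetCard S.card)]
  · refine Finset.sum_congr rfl fun T hT => ?_
    congr 1
    ext σ
    simp only [Finset.mem_filter, Finset.mem_univ, true_and]
    refine ⟨fun h => h.2, fun h => ⟨?_, h⟩⟩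
    rw [h]
    exact (Finset.mem_powersetCard.mp hT).1
  · intro σ hσ
    have hσ' : S.image σ ⊆ U := by simpa using hσ
    simpa [Finset.mem_powersetCard] using
      ⟨hσ', Finset.card_image_of_injective S σ.injective⟩

/-- The image of `S` under a uniformly random permutation is a uniformly random set of size `|S|`.
The common fibre size `N` is eliminated by comparing `U` with the whole type. -/
theorem card_perm_image_subset_mul_choose (S U : Finset α) :
    (Finset.univ.filter (fun σ : Equiv.Perm α => S.image σ ⊆ U)).card *
        (Fintype.card α).choose S.card =
      U.card.choose S.card * (Fintype.card α).factorial := by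
  set N := (Finset.univ.filter (fun σ : Equiv.Perm α => S.image σ = S)).card with hN
  have key : ∀ W : Finset α,
      (Finset.univ.filter (fun σ : Equiv.Perm α => S.image σ ⊆ W)).card =
        W.card.choose S.card * N := by
    intro W
    rw [card_perm_image_subset_eq_sum, Finset.sum_const_nat (m := N), Finset.card_powersetCard]
    intro T hT
    exact card_perm_image_eq_congr S (Finset.mem_powersetCard.mp hT).2
  have huniv := key Finset.univ
  simp only [Finset.subset_univ, Finset.filter_true, Finset.card_univ, Fintype.card_perm] at huniv
  rw [key U, huniv]
  ring

theorem card_perm_image_subset_le [Nonempty α] (S U : Finset α) :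
    ((Finset.univ.filter (fun σ : Equiv.Perm α => S.image σ ⊆ U)).card : ℝ) ≤
      (Fintype.card α).factorial * ((U.card : ℝ) / Fintype.card α) ^ S.card := by
  have h1 := card_perm_image_subset_mul_choose S U
  have h2 := choose_mul_pow_le_choose_mul_pow (Finset.card_le_univ U) S.card
  have hc : 0 < (Fintype.card α).choose S.card := Nat.choose_pos (Finset.card_le_univ S)
  have hn : (0 : ℝ) < Fintype.card α := by exact_mod_cast Fintype.card_pos
  rw [div_pow, mul_div_assoc', le_div_iff₀ (by positivity)]
  have h3 : (Finset.univ.filter (fun σ : Equiv.Perm α => S.image σ ⊆ U)).card *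
      Fintype.card α ^ S.card ≤ (Fintype.card α).factorial * U.card ^ S.card := by
    refine Nat.le_of_mul_le_mul_right (c := (Fintype.card α).choose S.card) ?_ hc
    calc _ = ((Finset.univ.filter (fun σ : Equiv.Perm α => S.image σ ⊆ U)).card *
        (Fintype.card α).choose S.card) * Fintype.card α ^ S.card := by ring
      _ = (Fintype.card α).factorial * (U.card.choose S.card * Fintype.card α ^ S.card) := by
        rw [h1]; ring
      _ ≤ (Fintype.card α).factorial * ((Fintype.card α).choose S.card * U.card ^ S.card) :=
        Nat.mul_le_mul_left _ h2
      _ = _ := by ring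
  exact_mod_cast h3

end Permutations

theorem choose_le_choose_of_le_half {n t s : ℕ} (hts : t ≤ s) (hs : s ≤ n / 2) :
    n.choose t ≤ n.choose s := by
  induction s, hts using Nat.le_induction with
  | base => exact le_rfl
  | succ s _ ih =>
    exact (ih (by omega)).trans (Nat.choose_le_succ_of_lt_half_left (by omega))

theorem choose_le_three_mul_div_pow {n s : ℕ} (hs : 0 < s) :
    (n.choose s : ℝ) ≤ (3 * n / s) ^ s := by
  have hs' : (0 : ℝ) < s := by exact_mod_cast hs
  have h1 : (n.choose s : ℝ) ≤ (n : ℝ) ^ s / s.factorial := Nat.choose_le_pow_div s n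
  have h2 : (s : ℝ) ^ s / s.factorial ≤ Real.exp s := Real.pow_div_factorial_le_exp _ hs'.le _
  have h3 : Real.exp s ≤ 3 ^ s := by
    rw [← Real.exp_one_pow]
    exact pow_le_pow_left₀ (Real.exp_pos _).le (Real.exp_one_lt_d9.le.trans (by norm_num)) _
  calc (n.choose s : ℝ) ≤ (n : ℝ) ^ s / s.factorial := h1
    _ = ((n : ℝ) / s) ^ s * ((s : ℝ) ^ s / s.factorial) := by
        rw [div_pow]; field_simp
    _ ≤ ((n : ℝ) / s) ^ s * 3 ^ s := by gcongr; exact h2.trans h3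
    _ = (3 * n / s) ^ s := by rw [← mul_pow]; congr 1; ring

/-- The binomials count the choices of `S` and of a superset `T` of its neighbourhood; the last
factor bounds the probability that 20 permutations all map `S` into `S ∪ T`. Each binomial is at
most `(3n/s)^s`, which uses up two of the 20 factors `s/n`; the other 18 are at most `1/2` and
outweigh the constants. -/
theorem expander_union_bound_term {n s : ℕ} (hs : 0 < s) (hsn : s ≤ n / 2) :
    (n.choose s : ℝ) * n.choose (s / 2) * ((((3 / 2 : ℝ) * s) / n) ^ s) ^ 20 ≤ (1 / 4) ^ s := by
  have hs' : (0 : ℝ) < s := by exact_mod_cast hs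
  have hn' : (0 : ℝ) < n := by exact_mod_cast (by omega : 0 < n)
  have hq : (s : ℝ) / n ≤ 1 / 2 := by
    rw [div_le_div_iff₀ hn' (by norm_num)]
    exact_mod_cast (by omega : s * 2 ≤ 1 * n)
  have h1 := choose_le_three_mul_div_pow (n := n) hs
  have h2 : (n.choose (s / 2) : ℝ) ≤ n.choose s := by
    exact_mod_cast choose_le_choose_of_le_half (Nat.div_le_self s 2) hsn
  calc (n.choose s : ℝ) * n.choose (s / 2) * ((((3 / 2 : ℝ) * s) / n) ^ s) ^ 20
      ≤ (3 * n / s) ^ s * (3 * n / s) ^ s * ((((3 / 2 : ℝ) * s) / n) ^ s) ^ 20 := by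
        gcongr
        exact h2.trans h1
    _ = ((3 * n / s) * (3 * n / s) * (((3 / 2 : ℝ) * s) / n) ^ 20) ^ s := by
        rw [mul_pow, mul_pow, ← pow_mul, ← pow_mul, mul_comm s 20]
    _ = (9 * (3 / 2) ^ 20 * ((s : ℝ) / n) ^ 18) ^ s := by
        congr 1
        field_simp
        norm_num
    _ ≤ (1 / 4) ^ s := by
        gcongr
        calc (9 * (3 / 2) ^ 20 * ((s : ℝ) / n) ^ 18) ≤ 9 * (3 / 2) ^ 20 * (1 / 2) ^ 18 := by gcongr
          _ ≤ 1 / 4 := by norm_num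

/-- The graph with an edge between `v` and `σ i v` for all `v` and `i`. -/
def permGraph {V ι : Type} (σ : ι → Equiv.Perm V) : SimpleGraph V :=
  SimpleGraph.fromRel (fun u v => ∃ i, σ i u = v)

theorem permGraph_neighborSet_ncard_le {V ι : Type} [Fintype ι] (σ : ι → Equiv.Perm V) (v : V) :
    ((permGraph σ).neighborSet v).ncard ≤ 2 * Fintype.card ι := by
  classical
  have hsub : (permGraph σ).neighborSet v ⊆
      (↑(Finset.univ.image (fun i => σ i v) ∪ Finset.univ.image (fun i => (σ i)⁻¹ v)) :
        Set V) := by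
    intro w hw
    rw [SimpleGraph.mem_neighborSet, permGraph, SimpleGraph.fromRel_adj] at hw
    rw [Finset.mem_coe, Finset.mem_union, Finset.mem_image, Finset.mem_image]
    rcases hw.2 with ⟨i, hi⟩ | ⟨i, hi⟩
    · exact Or.inl ⟨i, Finset.mem_univ _, hi⟩
    · exact Or.inr ⟨i, Finset.mem_univ _, by rw [← hi]; simp⟩
  refine (Set.ncard_le_ncard hsub (Finset.finite_toSet _)).trans ?_
  rw [Set.ncard_coe_finset, two_mul]
  refine (Finset.card_union_le _ _).trans (Nat.add_le_add ?_ ?_) <;>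
    exact Finset.card_image_le

theorem exists_perms_half_expanding (n : ℕ) [NeZero n] :
    ∃ σ : Fin 20 → Equiv.Perm (Fin n), ∀ S : Finset (Fin n), S.Nonempty → S.card ≤ n / 2 →
      S.card ≤ 2 * (openNeighborhood (permGraph σ) (S : Set (Fin n))).ncard := by
  classical
  by_contra hcon
  push Not at hcon
  set bad : Finset (Fin n) → Finset (Fin n) → Finset (Fin 20 → Equiv.Perm (Fin n)) :=
    fun S T => Fintype.piFinset
      (fun _ => Finset.univ.filter (fun σ : Equiv.Perm (Fin n) => S.image σ ⊆ S ∪ T)) with hbad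
  have hcover : (Finset.univ : Finset (Fin 20 → Equiv.Perm (Fin n))) ⊆
      (Finset.Icc 1 (n / 2)).biUnion (fun s => (Finset.univ.powersetCard s).biUnion
        (fun S => (Finset.univ.powersetCard (s / 2)).biUnion (fun T => bad S T))) := by
    intro σ _
    obtain ⟨S, hS, hSn, hlt⟩ := hcon σ
    set N := (openNeighborhood (permGraph σ) (S : Set (Fin n))).toFinite.toFinset with hN
    have hNcard : N.card = (openNeighborhood (permGraph σ) (S : Set (Fin n))).ncard :=
      (Set.ncard_eq_toFinset_card _ _).symm
    -- Padding the neighbourhood to exactly `|S| / 2` elements leaves a single binomial coefficient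
    -- of choices for `T`.
    obtain ⟨T, hNT, hT⟩ := Finset.exists_superset_card_eq (s := N) (n := S.card / 2)
      (by omega) (by rw [Fintype.card_fin]; omega)
    simp only [Finset.mem_biUnion, Finset.mem_Icc, Finset.mem_powersetCard, Finset.subset_univ,
      true_and]
    refine ⟨S.card, ⟨hS.card_pos, hSn⟩, S, rfl, T, hT, ?_⟩
    rw [hbad, Fintype.mem_piFinset]
    intro i
    rw [Finset.mem_filter]
    refine ⟨Finset.mem_univ _, fun w hw => ?_⟩
    obtain ⟨v, hv, rfl⟩ := Finset.mem_image.mp hw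
    by_cases hmem : σ i v ∈ S
    · exact Finset.mem_union_left _ hmem
    · refine Finset.mem_union_right _ (hNT ?_)
      rw [hN, Set.Finite.mem_toFinset]
      refine ⟨hmem, v, hv, ?_⟩
      rw [permGraph, SimpleGraph.fromRel_adj]
      refine ⟨?_, Or.inl ⟨i, rfl⟩⟩
      rintro h
      exact hmem (h ▸ hv)
  have hfac : (0 : ℝ) < (n.factorial : ℝ) ^ 20 := by positivity
  have hbadcard : ∀ s, ∀ S ∈ Finset.univ.powersetCard s, ∀ T ∈ Finset.univ.powersetCard (s / 2),
      ((bad S T).card : ℝ) ≤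
        (n.factorial : ℝ) ^ 20 * ((((3 / 2 : ℝ) * s) / n) ^ s) ^ 20 := by
    intro s S hS T hT
    have hS' := (Finset.mem_powersetCard.mp hS).2
    have hT' := (Finset.mem_powersetCard.mp hT).2
    have h1 := card_perm_image_subset_le S (S ∪ T)
    rw [Fintype.card_fin, hS'] at h1
    have hU : ((S ∪ T).card : ℝ) ≤ (3 / 2 : ℝ) * s := by
      have h2 : 2 * (S ∪ T).card ≤ 3 * s := by
        have := Finset.card_union_le S T
        omega
      have h3 : (2 : ℝ) * (S ∪ T).card ≤ 3 * s := by exact_mod_cast h2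
      linarith
    rw [hbad, Fintype.card_piFinset_const, ← mul_pow]
    push_cast
    gcongr
    refine h1.trans ?_
    gcongr
  have htotal : ((n.factorial : ℝ)) ^ 20 ≤
      ∑ s ∈ Finset.Icc 1 (n / 2), (n.factorial : ℝ) ^ 20 * (1 / 4) ^ s := by
    have h1 : ((Finset.univ : Finset (Fin 20 → Equiv.Perm (Fin n))).card : ℝ) =
        (n.factorial : ℝ) ^ 20 := by
      simp [Fintype.card_perm]
    rw [← h1]
    refine (Nat.cast_le.mpr ((Finset.card_le_card hcover).trans Finset.card_biUnion_le)).trans ?_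
    rw [Nat.cast_sum]
    refine Finset.sum_le_sum fun s hs => ?_
    rw [h1]
    rw [Finset.mem_Icc] at hs
    refine (Nat.cast_le.mpr Finset.card_biUnion_le).trans ?_
    rw [Nat.cast_sum]
    calc _ ≤ ∑ S ∈ (Finset.univ : Finset (Fin n)).powersetCard s,
          ∑ T ∈ (Finset.univ : Finset (Fin n)).powersetCard (s / 2),
          (n.factorial : ℝ) ^ 20 * ((((3 / 2 : ℝ) * s) / n) ^ s) ^ 20 := by
          refine Finset.sum_le_sum fun S hS => ?_
          refine (Nat.cast_le.mpr Finset.card_biUnion_le).trans ?_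
          rw [Nat.cast_sum]
          exact Finset.sum_le_sum fun T hT => hbadcard s S hS T hT
      _ = (n.factorial : ℝ) ^ 20 * ((n.choose s : ℝ) * n.choose (s / 2) *
          ((((3 / 2 : ℝ) * s) / n) ^ s) ^ 20) := by
          simp only [Finset.sum_const, Finset.card_powersetCard, Finset.card_univ,
            Fintype.card_fin, nsmul_eq_mul]
          ring
      _ ≤ _ := by
          gcongr
          exact expander_union_bound_term hs.1 hs.2
  rw [← Finset.mul_sum] at htotal
  -- The subtracted term makes the induction go through; only the bound `1/3` matters.
  have hgeom : ∀ m : ℕ, ∑ s ∈ Finset.Icc 1 m, (1 / 4 : ℝ) ^ s ≤ 1 / 3 - (1 / 3) * (1 / 4) ^ m := by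
    intro m
    induction m with
    | zero => simp
    | succ m ih =>
      rw [Finset.sum_Icc_succ_top (by omega), pow_succ]
      linarith
  have h3 := hgeom (n / 2)
  have h4 : (0 : ℝ) < (1 / 4) ^ (n / 2) := by positivity
  have h5 : ∑ s ∈ Finset.Icc 1 (n / 2), (1 / 4 : ℝ) ^ s < 1 := by linarith
  nlinarith

theorem le_expansion {V : Type} [Fintype V] (G : SimpleGraph V) (hV : 2 ≤ Fintype.card V) {d : ℝ}
    (h : ∀ S : Set V, S.Nonempty → (S.ncard : ℝ) ≤ (Fintype.card V : ℝ) / 2 →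
      d * S.ncard ≤ (openNeighborhood G S).ncard) : d ≤ expansion G := by
  have hV' : (2 : ℝ) ≤ Fintype.card V := by exact_mod_cast hV
  refine le_csInf ?_ ?_
  · obtain ⟨v⟩ : Nonempty V := Fintype.card_pos_iff.mp (by omega)
    -- A singleton has at most `|V| / 2` elements because `|V| ≥ 2`, so the infimum is over a
    -- nonempty set.
    exact ⟨_, {v}, Set.singleton_nonempty v, by rw [Set.ncard_singleton]; push_cast; linarith, rfl⟩
  · rintro r ⟨S, hS, hcard, rfl⟩
    have hpos : (0 : ℝ) < S.ncard := by
      exact_mod_cast (Set.ncard_pos S.toFinite).mpr hS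
    rw [le_div_iff₀ hpos]
    exact h S hS hcard

theorem expansion_mul_ncard_le {V : Type} [Fintype V] (G : SimpleGraph V) {S : Set V}
    (hcard : (S.ncard : ℝ) ≤ (Fintype.card V : ℝ) / 2) :
    expansion G * S.ncard ≤ (openNeighborhood G S).ncard := by
  rcases S.eq_empty_or_nonempty with rfl | hS
  · simp
  have hpos : (0 : ℝ) < S.ncard := by
    exact_mod_cast (Set.ncard_pos S.toFinite).mpr hS
  rw [← le_div_iff₀ hpos]
  refine csInf_le ⟨0, ?_⟩ ⟨S, hS, hcard, rfl⟩
  rintro r ⟨T, _, _, rfl⟩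
  positivity

theorem exists_expander (n : ℕ) (hn : 2 ≤ n) :
    ∃ G : SimpleGraph (Fin n), (∀ v, (G.neighborSet v).ncard ≤ 40) ∧ 1 / 2 ≤ expansion G := by
  classical
  have : NeZero n := ⟨by omega⟩
  obtain ⟨σ, hσ⟩ := exists_perms_half_expanding n
  refine ⟨permGraph σ, fun v => by simpa using permGraph_neighborSet_ncard_le σ v, ?_⟩
  refine le_expansion _ (by simpa using hn) fun S hS hcard => ?_
  have hfin : ((S.toFinset : Finset (Fin n)) : Set (Fin n)) = S := S.coe_toFinset
  rw [Fintype.card_fin, Set.ncard_eq_toFinset_card', le_div_iff₀ (by norm_num)] at hcard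
  have hle : S.toFinset.card * 2 ≤ n := by exact_mod_cast hcard
  have h := hσ S.toFinset (Set.toFinset_nonempty.mpr hS) (by omega)
  rw [hfin] at h
  rw [Set.ncard_eq_toFinset_card' S]
  have h' : (S.toFinset.card : ℝ) ≤ 2 * (openNeighborhood (permGraph σ) S).ncard := by
    exact_mod_cast h
  linarith

/-! ### Building circuits gate by gate -/

namespace Gate

variable {α β : Type}

def map (f : α → β) : Gate α → Gate β
  | .and a b => .and (f a) (f b)
  | .or a b => .or (f a) (f b)
  | .not a => .not (f a)

/-- The arguments of a gate. -/
def args : Gate α → List α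
  | .and a b => [a, b]
  | .or a b => [a, b]
  | .not a => [a]

theorem eval_map (f : α → β) (v : β → Bool) (g : Gate α) : (g.map f).eval v = g.eval (v ∘ f) := by
  cases g <;> rfl

end Gate

namespace Circuit

variable {ι : Type}

/-- The values of all variables of `C` on input `x`. -/
def value (C : Circuit ι) (x : ι → Bool) : C.Var → Bool := Sum.elim x (C.gateValue x)

theorem gateValue_eq (C : Circuit ι) (x : ι → Bool) (g : Fin C.size) :
    C.gateValue x g = (C.gate g).eval (C.value x ∘ C.argVar g) := by
  rw [gateValue]
  congr 1
  funext a
  cases a <;> rfl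

/-- Append the gate `g`, which becomes the output. -/
def snoc (C : Circuit ι) (g : Gate C.Var) : Circuit ι where
  size := C.size + 1
  gate i := if h : i.val < C.size then C.gate ⟨i.val, h⟩ else
    g.map (Sum.map id (Fin.cast (by omega)))
  output := Fin.last C.size

theorem gate_snoc_castSucc (C : Circuit ι) (g : Gate C.Var) (i : Fin C.size) :
    (C.snoc g).gate (Fin.castSucc i) = C.gate i := dif_pos i.isLt

theorem gateValue_snoc_castSucc (C : Circuit ι) (g : Gate C.Var) (x : ι → Bool) (i : Fin C.size) :
    (C.snoc g).gateValue x (Fin.castSucc i) = C.gateValue x i := by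
  obtain ⟨i, hi⟩ := i
  induction i using Nat.strong_induction_on with
  | _ i ih =>
    refine (gateValue_eq _ _ _).trans ?_
    rw [gate_snoc_castSucc, gateValue_eq C]
    congr 1
    funext a
    cases a with
    | inl a => rfl
    | inr a => exact ih a.val a.isLt _

theorem value_snoc (C : Circuit ι) (g : Gate C.Var) (x : ι → Bool) (w : C.Var) :
    (C.snoc g).value x (Sum.map id Fin.castSucc w) = C.value x w := by
  cases w with
  | inl a => rfl
  | inr a => exact gateValue_snoc_castSucc C g x a

theorem eval_snoc (C : Circuit ι) (g : Gate C.Var) (x : ι → Bool) :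
    (C.snoc g).eval x = g.eval (C.value x) := by
  have hgate : (C.snoc g).gate (Fin.last C.size) = g.map (Sum.map id (Fin.cast (by simp))) :=
    dif_neg (lt_irrefl _)
  refine (gateValue_eq (C.snoc g) x (Fin.last C.size)).trans ?_
  rw [hgate, Gate.eval_map]
  congr 1
  funext a
  exact (congrArg ((C.snoc g).value x) (by cases a <;> rfl)).trans (value_snoc C g x a)

/-- Some variable of `C` has the value `f`. -/
def Computes (C : Circuit ι) (f : (ι → Bool) → Bool) : Prop := ∃ w : C.Var, ∀ x, C.value x w = f x

/-- Every input is an argument of some gate. -/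
def UsesInputs (C : Circuit ι) : Prop := ∀ i, ∃ g, Sum.inl i ∈ (C.gate g).args

/-- `C'` has `k` more gates than `C` and computes whatever `C` computes. -/
structure ExtendsBy (C C' : Circuit ι) (k : ℕ) : Prop where
  size_eq : C'.size = C.size + k
  computes : ∀ f, C.Computes f → C'.Computes f
  usesInputs : C.UsesInputs → C'.UsesInputs

theorem ExtendsBy.trans {C C' C'' : Circuit ι} {k l : ℕ} (h : C.ExtendsBy C' k)
    (h' : C'.ExtendsBy C'' l) : C.ExtendsBy C'' (k + l) :=
  ⟨by rw [h'.size_eq, h.size_eq, add_assoc], fun f hf => h'.computes f (h.computes f hf),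
    fun hu => h'.usesInputs (h.usesInputs hu)⟩

theorem extendsBy_snoc (C : Circuit ι) (g : Gate C.Var) : C.ExtendsBy (C.snoc g) 1 where
  size_eq := rfl
  computes := by
    rintro f ⟨w, hw⟩
    exact ⟨Sum.map id Fin.castSucc w, fun x => (value_snoc C g x w).trans (hw x)⟩
  usesInputs := by
    intro h i
    obtain ⟨j, hj⟩ := h i
    refine ⟨Fin.castSucc j, ?_⟩
    rw [gate_snoc_castSucc]
    exact hj

theorem computes_eval (C : Circuit ι) : C.Computes C.eval := ⟨Sum.inr C.output, fun _ => rfl⟩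

theorem computes_input (C : Circuit ι) (i : ι) : C.Computes (fun x => x i) :=
  ⟨Sum.inl i, fun _ => rfl⟩

/-- The conclusion is about `eval`, since the final negation in the circuit for `¬IP_G` has to be
the output gate. -/
theorem exists_extendsBy_not (C : Circuit ι) {f : (ι → Bool) → Bool} (hf : C.Computes f) :
    ∃ C', C.ExtendsBy C' 1 ∧ ∀ x, C'.eval x = !(f x) := by
  obtain ⟨w, hw⟩ := hf
  exact ⟨_, C.extendsBy_snoc (.not w), fun x => by rw [eval_snoc, ← hw x]; rfl⟩

theorem exists_extendsBy_and (C : Circuit ι) {f g : (ι → Bool) → Bool} (hf : C.Computes f)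
    (hg : C.Computes g) : ∃ C', C.ExtendsBy C' 1 ∧ C'.Computes (fun x => f x && g x) := by
  obtain ⟨w, hw⟩ := hf
  obtain ⟨w', hw'⟩ := hg
  refine ⟨_, C.extendsBy_snoc (.and w w'), Sum.inr (Fin.last _), fun x => ?_⟩
  refine (eval_snoc C (.and w w') x).trans ?_
  simp only [← hw, ← hw']; rfl

theorem exists_extendsBy_or (C : Circuit ι) {f g : (ι → Bool) → Bool} (hf : C.Computes f)
    (hg : C.Computes g) : ∃ C', C.ExtendsBy C' 1 ∧ C'.Computes (fun x => f x || g x) := by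
  obtain ⟨w, hw⟩ := hf
  obtain ⟨w', hw'⟩ := hg
  refine ⟨_, C.extendsBy_snoc (.or w w'), Sum.inr (Fin.last _), fun x => ?_⟩
  refine (eval_snoc C (.or w w') x).trans ?_
  simp only [← hw, ← hw']; rfl

/-- The four gates compute `(f ∨ g) ∧ ¬(f ∧ g)`. -/
theorem exists_extendsBy_xor (C : Circuit ι) {f g : (ι → Bool) → Bool} (hf : C.Computes f)
    (hg : C.Computes g) : ∃ C', C.ExtendsBy C' 4 ∧ C'.Computes (fun x => xor (f x) (g x)) := by
  obtain ⟨C₁, h₁, hand⟩ := C.exists_extendsBy_and hf hg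
  obtain ⟨C₂, h₂, hnand⟩ := C₁.exists_extendsBy_not hand
  have h₁₂ := h₁.trans h₂
  obtain ⟨C₃, h₃, hor⟩ := C₂.exists_extendsBy_or (h₁₂.computes f hf) (h₁₂.computes g hg)
  obtain ⟨C₄, h₄, w, hw⟩ := C₃.exists_extendsBy_and hor (h₃.computes _ C₂.computes_eval)
  refine ⟨C₄, (h₁₂.trans h₃).trans h₄, w, fun x => ?_⟩
  rw [hw x]
  simp only [hnand]
  cases f x <;> cases g x <;> rfl

/-- The circuit whose gates are the negations of the inputs. -/
def negations (n : ℕ) (hn : 0 < n) : Circuit (Fin n) where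
  size := n
  gate g := .not (Sum.inl g)
  output := ⟨0, hn⟩

/-- Starting every construction from the negations makes each input occur in the Tseitin clauses, as
`PCNF.closed` requires, whatever the graph is. -/
theorem negations_usesInputs (n : ℕ) (hn : 0 < n) : (negations n hn).UsesInputs :=
  fun i => ⟨i, by simp [negations, Gate.args]⟩

theorem negations_eval (n : ℕ) (hn : 0 < n) (x : Fin n → Bool) :
    (negations n hn).eval x = !(x ⟨0, hn⟩) := by
  rw [eval, gateValue_eq]
  rfl

end Circuit

/-- The product of the values of the two ends of the edge `e`. -/
def edgeProduct {V : Type} (x : V → Bool) (e : Sym2 V) : ZMod 2 :=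
  (e.map (fun v => if x v then (1 : ZMod 2) else 0)).mul

theorem Circuit.exists_extendsBy_sum_edgeProduct {n : ℕ} (hn : 0 < n) (E : Finset (Sym2 (Fin n))) :
    ∃ C : Circuit (Fin n), C.size = n + 1 + 5 * E.card ∧ C.UsesInputs ∧
      C.Computes (fun x => decide (∑ e ∈ E, edgeProduct x e = 1)) := by
  classical
  induction E using Finset.induction_on with
  | empty =>
    -- The empty sum is the constant 0, computed as `x₀ ∧ ¬x₀`. Each edge then costs five gates: one
    -- for the product and four for the exclusive or.
    obtain ⟨C, hC, w, hw⟩ := (negations n hn).exists_extendsBy_and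
      ((negations n hn).computes_input ⟨0, hn⟩) (negations n hn).computes_eval
    refine ⟨C, hC.size_eq, hC.usesInputs (negations_usesInputs n hn), w, fun x => ?_⟩
    rw [hw x]
    simp [negations_eval]
  | insert e E he ih =>
    obtain ⟨C, hsize, huses, hcomp⟩ := ih
    obtain ⟨u, v⟩ := e
    obtain ⟨C₁, h₁, hand⟩ :=
      C.exists_extendsBy_and (C.computes_input u) (C.computes_input v)
    obtain ⟨C₂, h₂, w, hw⟩ := C₁.exists_extendsBy_xor hand (h₁.computes _ hcomp)
    have h₁₂ := h₁.trans h₂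
    refine ⟨C₂, ?_, h₁₂.usesInputs huses, w, fun x => ?_⟩
    · rw [h₁₂.size_eq, hsize, Finset.card_insert_of_notMem he]
      omega
    · rw [hw x]
      beta_reduce
      rw [Finset.sum_insert he]
      have hadd : ∀ a b : ZMod 2, decide (a + b = 1) = xor (decide (a = 1)) (decide (b = 1)) := by
        decide
      rw [hadd]
      congr 1
      change _ = decide ((if x u then (1 : ZMod 2) else 0) * (if x v then (1 : ZMod 2) else 0) = 1)
      cases x u <;> cases x v <;> simp

theorem innerProduct_eq {V : Type} [Fintype V] (G : SimpleGraph V) [Fintype G.edgeSet]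
    (x : V → Bool) : innerProduct G x = decide (∑ e ∈ G.edgeFinset, edgeProduct x e = 1) := by
  unfold innerProduct edgeProduct
  congr!

theorem card_edgeFinset_le {V : Type} [Fintype V] [DecidableEq V] (G : SimpleGraph V)
    [DecidableRel G.Adj] {k : ℕ} (h : ∀ v, (G.neighborSet v).ncard ≤ 2 * k) :
    G.edgeFinset.card ≤ k * Fintype.card V := by
  have h1 := G.sum_degrees_eq_twice_card_edges
  have h2 : ∑ v, G.degree v ≤ Fintype.card V * (2 * k) := by
    rw [← Finset.card_univ, ← smul_eq_mul]
    refine Finset.sum_le_card_nsmul _ _ _ fun v _ => ?_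
    rw [← G.card_neighborSet_eq_degree, ← Nat.card_eq_fintype_card]
    exact h v
  nlinarith

theorem exists_circuit_not_innerProduct {n k : ℕ} (hn : 0 < n) (G : SimpleGraph (Fin n))
    (h : ∀ v, (G.neighborSet v).ncard ≤ 2 * k) :
    ∃ C : Circuit (Fin n), C.size ≤ n + 2 + 5 * (k * n) ∧ C.UsesInputs ∧
      ∀ x, C.eval x = !(innerProduct G x) := by
  classical
  obtain ⟨C, hsize, huses, hcomp⟩ := Circuit.exists_extendsBy_sum_edgeProduct hn G.edgeFinset
  obtain ⟨C', h', heval⟩ := C.exists_extendsBy_not hcomp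
  refine ⟨C', ?_, h'.usesInputs huses, fun x => ?_⟩
  · have := card_edgeFinset_le G h
    rw [Fintype.card_fin] at this
    rw [h'.size_eq, hsize]
    omega
  · rw [heval, innerProduct_eq]

/-! ### The Tseitin transformation -/

namespace Circuit

theorem gateClauses_eval_iff {ι : Type} (C : Circuit ι) (g : Fin C.size) (a : C.Var → Bool) :
    (C.gateClauses g).eval a = true ↔ a (Sum.inr g) = (C.gate g).eval (a ∘ C.argVar g) := by
  unfold gateClauses
  rcases C.gate g with ⟨u, v⟩ | ⟨u, v⟩ | u
  all_goals
    simp only [CNFormula.eval, Clause.eval, Literal.eval, Gate.eval, List.all_cons, List.all_nil,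
      List.any_cons, List.any_nil, Function.comp_apply]
  · cases a (Sum.inr g) <;> cases a (C.argVar g u) <;> cases a (C.argVar g v) <;> simp
  · cases a (Sum.inr g) <;> cases a (C.argVar g u) <;> cases a (C.argVar g v) <;> simp
  · cases a (Sum.inr g) <;> cases a (C.argVar g u) <;> simp

/-- Gates are numbered topologically, so by strong induction the clauses force each gate to its
computed value. -/
theorem tseitin_eval_iff {ι : Type} (C : Circuit ι) (a : C.Var → Bool) :
    C.tseitin.eval a = true ↔ a = C.value (a ∘ Sum.inl) := by
  have h1 : C.tseitin.eval a = true ↔ ∀ g, (C.gateClauses g).eval a = true := by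
    simp [tseitin, CNFormula.eval]
  simp only [h1, gateClauses_eval_iff]
  constructor
  · intro h
    have key : ∀ i (hi : i < C.size), a (Sum.inr ⟨i, hi⟩) = C.gateValue (a ∘ Sum.inl) ⟨i, hi⟩ := by
      intro i
      induction i using Nat.strong_induction_on with
      | _ i ih =>
        intro hi
        rw [h, gateValue_eq]
        congr 1
        funext b
        cases b with
        | inl b => rfl
        | inr b => exact ih b.val b.isLt _
    funext w
    cases w with
    | inl i => rfl
    | inr g => exact key g.val g.isLt
  · intro h g
    have h2 : a (Sum.inr g) = C.gateValue (a ∘ Sum.inl) g := congrFun h (Sum.inr g)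
    rw [h2, gateValue_eq, ← h]

theorem exists_mem_gateClauses_var {ι : Type} (C : Circuit ι) (g : Fin C.size) :
    ∃ D ∈ C.gateClauses g, ∃ l ∈ D, l.var = Sum.inr g := by
  unfold gateClauses
  rcases C.gate g with ⟨u, v⟩ | ⟨u, v⟩ | u <;> simp

theorem exists_mem_gateClauses_argVar {ι : Type} (C : Circuit ι) (g : Fin C.size)
    {b : ι ⊕ Fin g.val} (hb : b ∈ (C.gate g).args) :
    ∃ D ∈ C.gateClauses g, ∃ l ∈ D, l.var = C.argVar g b := by
  unfold gateClauses
  revert hb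
  rcases C.gate g with ⟨u, v⟩ | ⟨u, v⟩ | u <;> simp only [Gate.args] <;> intro hb <;>
    simp only [List.mem_cons, List.not_mem_nil, or_false] at hb <;> aesop

theorem gateClauses_size_le {ι : Type} (C : Circuit ι) (g : Fin C.size) :
    ((C.gateClauses g).map (fun D => D.length + 1)).sum ≤ 10 := by
  unfold gateClauses
  rcases C.gate g with ⟨u, v⟩ | ⟨u, v⟩ | u <;> simp

theorem tseitin_size_le {ι : Type} (C : Circuit ι) :
    (C.tseitin.map (fun D => D.length + 1)).sum ≤ 10 * C.size := by
  have h : ∀ l : List (Fin C.size),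
      ((l.flatMap C.gateClauses).map (fun D => D.length + 1)).sum ≤ 10 * l.length := by
    intro l
    induction l with
    | nil => simp
    | cons g l ih =>
      rw [List.flatMap_cons, List.map_append, List.sum_append, List.length_cons]
      have := C.gateClauses_size_le g
      omega
  simpa [tseitin] using h (List.finRange C.size)

variable {n : ℕ} (C : Circuit (Fin n))

theorem map_snd_existsForallExists :
    C.existsForallExists.map Prod.snd = (List.finRange n).map Sum.inl ++
      Sum.inr C.output :: ((List.finRange C.size).filter (fun g => g ≠ C.output)).map Sum.inr := by
  simp [existsForallExists, Function.comp_def]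

theorem mem_map_snd_existsForallExists (v : C.Var) : v ∈ C.existsForallExists.map Prod.snd := by
  rw [map_snd_existsForallExists]
  rcases v with i | g
  · simp
  · by_cases h : g = C.output
    · simp [h]
    · simp [h]

theorem nodup_map_snd_existsForallExists : (C.existsForallExists.map Prod.snd).Nodup := by
  rw [map_snd_existsForallExists, List.nodup_append]
  refine ⟨(List.nodup_finRange n).map Sum.inl_injective, ?_, ?_⟩
  · rw [List.nodup_cons]
    refine ⟨by simp, ((List.nodup_finRange _).filter _).map Sum.inr_injective⟩
  · intro a ha b hb
    simp only [List.mem_map] at ha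
    obtain ⟨i, _, rfl⟩ := ha
    rintro rfl
    simp at hb

theorem length_existsForallExists_le : C.existsForallExists.length ≤ n + 1 + C.size := by
  have := List.length_filter_le (fun g => decide (g ≠ C.output)) (List.finRange C.size)
  rw [List.length_finRange] at this
  simp only [existsForallExists, List.length_append, List.length_map, List.length_finRange,
    List.length_cons]
  omega

/-- The formula `∃ X ∀ z ∃ Y. φ` for the Tseitin transformation `φ` of `C`. -/
def pcnf (h : C.UsesInputs) : PCNF C.Var where
  quants := C.existsForallExists
  matrix := C.tseitin
  nodup := C.nodup_map_snd_existsForallExists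
  closed v := by
    refine iff_of_true (C.mem_map_snd_existsForallExists v) ?_
    have key : ∃ g, ∃ D ∈ C.gateClauses g, ∃ l ∈ D, l.var = v := by
      rcases v with i | g
      · obtain ⟨g, hg⟩ := h i
        exact ⟨g, C.exists_mem_gateClauses_argVar g hg⟩
      · exact ⟨g, C.exists_mem_gateClauses_var g⟩
    obtain ⟨g, D, hD, hl⟩ := key
    exact ⟨D, List.mem_flatMap.mpr ⟨g, List.mem_finRange g, hD⟩, hl⟩

theorem isUniversal_pcnf_iff (h : C.UsesInputs) (u : C.Var) :
    (C.pcnf h).IsUniversal u ↔ u = Sum.inr C.output := by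
  simp [PCNF.IsUniversal, pcnf, existsForallExists]

theorem leftOf_output_pcnf_iff (h : C.UsesInputs) (v : C.Var) :
    (C.pcnf h).LeftOf v (Sum.inr C.output) ↔ ∃ i, v = Sum.inl i := by
  unfold PCNF.LeftOf
  change [v, Sum.inr C.output].Sublist (C.existsForallExists.map Prod.snd) ↔ _
  rw [map_snd_existsForallExists]
  constructor
  · intro hsub
    rw [List.sublist_append_iff] at hsub
    obtain ⟨l₁, l₂, hl, h₁, h₂⟩ := hsub
    cases l₁ with
    | nil =>
      rw [List.nil_append] at hl
      subst hl
      have h₃ := List.Sublist.tail h₂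
      have := h₃.subset (List.mem_singleton_self _)
      simp at this
    | cons w l₁ =>
      rw [List.cons_append, List.cons.injEq] at hl
      have := h₁.subset (List.mem_cons_self)
      rw [List.mem_map] at this
      obtain ⟨i, _, hi⟩ := this
      exact ⟨i, hl.1.trans hi.symm⟩
  · rintro ⟨i, rfl⟩
    refine List.Sublist.append (l₁ := [Sum.inl i]) (r₁ := [Sum.inr C.output]) ?_ ?_
    · rw [List.singleton_sublist]
      simp
    · rw [List.singleton_sublist]
      simp

theorem size_pcnf_le (h : C.UsesInputs) : (C.pcnf h).size ≤ n + 1 + 11 * C.size := by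
  have h1 := C.length_existsForallExists_le
  have h2 := C.tseitin_size_le
  change C.existsForallExists.length + (C.tseitin.map (fun D => D.length + 1)).sum ≤ _
  omega

theorem isFalse_pcnf (h : C.UsesInputs) : (C.pcnf h).IsFalse := by
  -- The universal player sets `z` to the opposite of the value that the Tseitin clauses force on
  -- the output gate.
  refine ⟨fun _ τ => !(C.eval (τ ∘ Sum.inl)), fun u hu τ σ hτσ => ?_, fun ρ hρ => ?_⟩
  · rw [isUniversal_pcnf_iff] at hu
    subst hu
    have : τ ∘ Sum.inl = σ ∘ Sum.inl :=
      funext fun i => hτσ _ ((C.leftOf_output_pcnf_iff h _).mpr ⟨i, rfl⟩)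
    simp only [this]
  · rw [← Bool.not_eq_true]
    intro hsat
    have h1 := (C.tseitin_eval_iff ρ).mp hsat
    have h2 := hρ _ ((C.isUniversal_pcnf_iff h _).mpr rfl)
    have h3 : ρ (Sum.inr C.output) = C.eval (ρ ∘ Sum.inl) := congrFun h1 (Sum.inr C.output)
    rw [h3] at h2
    exact Bool.not_ne_self _ h2.symm

end Circuit

/-! ### Cutting an OBDD at a position of the variable order -/

namespace OBDD

variable {V : Type} [Fintype V] {π : VarOrder V}

theorem eval_congr (B : OBDD V π) {a b : V → Bool} (h : ∀ v ∈ B.vars, a v = b v) :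
    B.eval a = B.eval b := by
  have hstep : B.step a = B.step b := by
    funext q
    cases q with
    | inl i => simp only [step, h _ (Set.mem_range_self i)]
    | inr _ => rfl
  unfold eval endpoint
  rw [hstep]

/-- Like `step`, but stays at nodes whose label has position at least `p`. -/
def stepBelow (B : OBDD V π) (p : ℕ) (a : V → Bool) : Fin B.inner ⊕ Bool → Fin B.inner ⊕ Bool
  | .inl i => if (π (B.label i)).val < p then B.child i (a (B.label i)) else .inl i
  | .inr b => .inr b

/-- The sinks and the nodes whose label has position at least `p`. -/
def IsAbove (B : OBDD V π) (p : ℕ) : Fin B.inner ⊕ Bool → Prop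
  | .inl i => p ≤ (π (B.label i)).val
  | .inr _ => True

/-- The first node on the path of `a` that is a sink or has a label of position at least `p`. -/
def cutNode (B : OBDD V π) (p : ℕ) (a : V → Bool) : Fin B.inner ⊕ Bool :=
  (B.stepBelow p a)^[B.inner] B.root

/-- The label of the sink reached from `q` on the path of `a`. -/
def evalFrom (B : OBDD V π) (a : V → Bool) (q : Fin B.inner ⊕ Bool) : Bool :=
  match (B.step a)^[B.inner] q with
  | .inl _ => false
  | .inr b => b

theorem stepBelow_of_isAbove (B : OBDD V π) {p : ℕ} (a : V → Bool) {q : Fin B.inner ⊕ Bool}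
    (h : B.IsAbove p q) : B.stepBelow p a q = q := by
  cases q with
  | inl i => exact if_neg (not_lt.mpr h)
  | inr _ => rfl

theorem stepBelow_of_not_isAbove (B : OBDD V π) {p : ℕ} (a : V → Bool) {q : Fin B.inner ⊕ Bool}
    (h : ¬ B.IsAbove p q) : B.stepBelow p a q = B.step a q := by
  cases q with
  | inl i => exact if_pos (not_le.mp h)
  | inr _ => rfl

/-- The walk that stalls at the cut follows a prefix of the true path: either it has not stalled
yet, or it rests at a node beyond the cut. -/
theorem exists_iterate_stepBelow_eq (B : OBDD V π) (p : ℕ) (a : V → Bool) (k : ℕ) :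
    ∃ m ≤ k, (B.stepBelow p a)^[k] B.root = (B.step a)^[m] B.root ∧
      (m = k ∨ B.IsAbove p ((B.stepBelow p a)^[k] B.root)) := by
  induction k with
  | zero => exact ⟨0, le_rfl, rfl, Or.inl rfl⟩
  | succ k ih =>
    obtain ⟨m, hm, heq, hor⟩ := ih
    rw [Function.iterate_succ_apply']
    by_cases hab : B.IsAbove p ((B.stepBelow p a)^[k] B.root)
    · rw [stepBelow_of_isAbove _ _ hab]
      exact ⟨m, by omega, heq, Or.inr hab⟩
    · obtain rfl := hor.resolve_right hab
      refine ⟨m + 1, le_rfl, ?_, Or.inl rfl⟩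
      rw [stepBelow_of_not_isAbove _ _ hab, heq, Function.iterate_succ_apply']

theorem iterate_step_sink (B : OBDD V π) (a : V → Bool) (b : Bool) (m : ℕ) :
    (B.step a)^[m] (Sum.inr b) = Sum.inr b :=
  Function.iterate_fixed rfl m

theorem isAbove_cutNode (B : OBDD V π) (p : ℕ) (a : V → Bool) : B.IsAbove p (B.cutNode p a) := by
  obtain ⟨m, _, heq, rfl | h⟩ := B.exists_iterate_stepBelow_eq p a B.inner
  · obtain ⟨b, hb⟩ := B.exists_endpoint_eq a
    unfold cutNode
    rw [heq]
    unfold endpoint at hb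
    rw [hb]
    trivial
  · exact h

theorem evalFrom_cutNode (B : OBDD V π) (p : ℕ) (a : V → Bool) :
    B.evalFrom a (B.cutNode p a) = B.eval a := by
  obtain ⟨m, _, heq, _⟩ := B.exists_iterate_stepBelow_eq p a B.inner
  obtain ⟨b, hb⟩ := B.exists_endpoint_eq a
  have h : (B.step a)^[B.inner] (B.cutNode p a) = Sum.inr b := by
    unfold cutNode
    -- In total `m + B.inner` steps are taken from the root. The first `B.inner` of them already
    -- reach a sink, and the rest stay there.
    rw [heq, ← Function.iterate_add_apply, add_comm, Function.iterate_add_apply]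
    change (B.step a)^[m] (B.endpoint a) = _
    rw [hb, iterate_step_sink]
  unfold evalFrom eval
  rw [h, hb]

theorem cutNode_congr (B : OBDD V π) {p : ℕ} {a b : V → Bool}
    (h : ∀ v, (π v).val < p → a v = b v) : B.cutNode p a = B.cutNode p b := by
  have hstep : B.stepBelow p a = B.stepBelow p b := by
    funext q
    cases q with
    | inl i =>
      by_cases hi : (π (B.label i)).val < p
      · simp only [stepBelow, if_pos hi, h _ hi]
      · simp only [stepBelow, if_neg hi]
    | inr _ => rfl
  unfold cutNode
  rw [hstep]

theorem evalFrom_congr (B : OBDD V π) {p : ℕ} {a b : V → Bool}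
    (h : ∀ v, p ≤ (π v).val → a v = b v) {q : Fin B.inner ⊕ Bool} (hq : B.IsAbove p q) :
    B.evalFrom a q = B.evalFrom b q := by
  have key : ∀ k, (B.step a)^[k] q = (B.step b)^[k] q ∧ B.IsAbove p ((B.step b)^[k] q) := by
    intro k
    induction k with
    | zero => exact ⟨rfl, hq⟩
    | succ k ih =>
      rw [Function.iterate_succ_apply', Function.iterate_succ_apply', ih.1]
      have hab := ih.2
      cases hr : (B.step b)^[k] q with
      | inr c => exact ⟨rfl, trivial⟩
      | inl i =>
        rw [hr] at hab
        have hab' : p ≤ (π (B.label i)).val := hab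
        refine ⟨by simp only [step, h _ hab'], ?_⟩
        simp only [step]
        cases hc : B.child i (b (B.label i)) with
        | inr c => trivial
        | inl j => exact hab'.trans (le_of_lt (B.ordered i _ j hc))
  unfold evalFrom
  rw [(key B.inner).1]

/-- The variables before the cut determine the node where the path crosses it, and the variables
after the cut determine the rest. So each node contributes one rectangle of zeros. -/
theorem eval_eq_evalFrom_cutNode (B : OBDD V π) {p : ℕ} {a b c : V → Bool}
    (hac : ∀ v, (π v).val < p → c v = a v) (hbc : ∀ v, p ≤ (π v).val → c v = b v) :
    B.eval c = B.evalFrom b (B.cutNode p a) := by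
  rw [← B.evalFrom_cutNode p c, B.cutNode_congr hac]
  exact B.evalFrom_congr hbc (B.isAbove_cutNode p a)

end OBDD

/-! ### Strategy extraction -/

/-- `t` is the first element of `T` with property `hit`. -/
def IsFirst {τ : Type*} (T : List τ) (hit : τ → Prop) (t : τ) : Prop :=
  ∃ l r, T = l ++ t :: r ∧ hit t ∧ ∀ s ∈ l, ¬ hit s

section Extraction

variable {V : Type} [Fintype V] [DecidableEq V] {π : VarOrder V}

/-- Invariant: an assignment that satisfies the matrix and obeys the list satisfies every line so
far. Where no entry fires, obeying is no condition. Only universal reduction extends the list,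
because the other rules preserve truth under `ρ`. -/
theorem IsDerivation.exists_decisionList_take {Φ : PCNF V} {u : V}
    (hu : ∀ v, Φ.IsUniversal v → v = u) {D : List (OBDD V π)} (hD : IsDerivation Φ D) (k : ℕ)
    (hk : k ≤ D.length) :
    ∃ T : List (OBDD V π × Bool), (T.map Prod.fst).Sublist (D.take k) ∧
      (∀ t ∈ T, ∀ a b : V → Bool, (∀ x, Φ.LeftOf x u → a x = b x) → t.1.eval a = t.1.eval b) ∧
      ∀ ρ : V → Bool, Φ.matrix.eval ρ = true →
        (∀ t, IsFirst T (fun s => s.1.eval ρ = false) t → ρ u = t.2) →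
        ∀ B ∈ D.take k, B.eval ρ = true := by
  induction k with
  | zero => exact ⟨[], by simp, by simp, by simp⟩
  | succ k ih =>
    obtain ⟨T, hsub, hdep, hsound⟩ := ih (by omega)
    have hlt : k < D.length := by omega
    have htake : D.take (k + 1) = D.take k ++ [D[k]] := by
      rw [List.take_add_one, List.getElem?_eq_getElem hlt]
      rfl
    have hsub' : (T.map Prod.fst).Sublist (D.take (k + 1)) := by
      rw [htake]
      exact hsub.trans (List.sublist_append_left _ _)
    rw [htake] at hsub' ⊢
    have hsimple : (∀ ρ : V → Bool, Φ.matrix.eval ρ = true →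
        (∀ B ∈ D.take k, B.eval ρ = true) → D[k].eval ρ = true) →
        ∃ T : List (OBDD V π × Bool), (T.map Prod.fst).Sublist (D.take k ++ [D[k]]) ∧
      (∀ t ∈ T, ∀ a b : V → Bool, (∀ x, Φ.LeftOf x u → a x = b x) → t.1.eval a = t.1.eval b) ∧
      ∀ ρ : V → Bool, Φ.matrix.eval ρ = true →
        (∀ t, IsFirst T (fun s => s.1.eval ρ = false) t → ρ u = t.2) →
        ∀ B ∈ D.take k ++ [D[k]], B.eval ρ = true := by
      intro hstep
      refine ⟨T, hsub', hdep, fun ρ hρ hT B hB => ?_⟩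
      rcases List.mem_append.mp hB with hB | hB
      · exact hsound ρ hρ hT B hB
      · rw [List.mem_singleton.mp hB]
        exact hstep ρ hρ (hsound ρ hρ hT)
    obtain ⟨hinit, hder⟩ := hD.2 k hlt
    by_cases hm : k < Φ.matrix.length
    · refine hsimple fun ρ hρ _ => ?_
      rw [hinit hm ρ]
      exact List.all_eq_true.mp hρ _ (List.getElem_mem hm)
    · rcases hder (not_lt.mp hm) with ⟨L, L', hL, hL', h⟩ | ⟨L, hL, x, _, h⟩ | ⟨S, hS, h⟩ |
        ⟨L, hL, w, c, hw, _, hright, h⟩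
      · refine hsimple fun ρ _ hprev => ?_
        rw [h ρ]
        beta_reduce
        rw [hprev L hL, hprev L' hL']
        rfl
      · refine hsimple fun ρ _ hprev => ?_
        rw [h ρ]
        beta_reduce
        have hself := Function.update_eq_self x ρ
        cases hx : ρ x with
        | false =>
          rw [hx] at hself
          rw [hself, hprev L hL, Bool.true_or]
        | true =>
          rw [hx] at hself
          rw [hself, hprev L hL, Bool.or_true]
      · exact hsimple fun ρ _ hprev => h ρ fun L hL => hprev L (hS L hL)
      · obtain rfl := hu w hw
        -- The new entry goes last, so it is consulted only when all earlier ones are satisfied. If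
        -- it fires, obedience gives `ρ w = c`, so `L[w/c]` agrees with `L` at `ρ`, which is true
        -- there.
        refine ⟨T ++ [(D[k], c)], ?_, ?_, fun ρ hρ hT B hB => ?_⟩
        · rw [List.map_append]
          exact hsub.append (List.Sublist.refl _)
        · intro t ht a b hab
          rcases List.mem_append.mp ht with ht | ht
          · exact hdep t ht a b hab
          · rw [List.mem_singleton.mp ht]
            change D[k].eval a = D[k].eval b
            rw [h a, h b]
            refine L.eval_congr fun v hv => ?_
            rcases eq_or_ne v w with rfl | hvw
            · simp
            · rw [Function.update_of_ne hvw, Function.update_of_ne hvw]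
              exact hab v ((hright v hv).resolve_left hvw)
        · have hprev := hsound ρ hρ fun t ⟨l, r, hl, ht, hmin⟩ =>
            hT t ⟨l, r ++ [(D[k], c)], by rw [hl]; simp, ht, hmin⟩
          rcases List.mem_append.mp hB with hB | hB
          · exact hprev B hB
          · rw [List.mem_singleton.mp hB, ← Bool.not_eq_false]
            intro hfalse
            have hρw : ρ w = c := hT (D[k], c) ⟨T, [], rfl, hfalse, fun s hs => by
              simp [hprev s.1 (hsub.subset (List.mem_map_of_mem hs))]⟩
            rw [h ρ, ← hρw] at hfalse
            beta_reduce at hfalse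
            rw [Function.update_eq_self, hprev L hL] at hfalse
            exact Bool.noConfusion hfalse

/-- From a refutation of a formula with one universal variable `u` one obtains a decision list of
OBDDs that depend only on the variables left of `u` and whose answers for `u` are winning. -/
theorem IsRefutation.exists_decisionList {Φ : PCNF V} {u : V}
    (hu : ∀ v, Φ.IsUniversal v → v = u) {D : List (OBDD V π)} (hD : IsRefutation Φ D) :
    ∃ T : List (OBDD V π × Bool), (T.map (fun t => t.1.size)).sum ≤ derivationSize D ∧
      (∀ t ∈ T, ∀ a b : V → Bool, (∀ x, Φ.LeftOf x u → a x = b x) → t.1.eval a = t.1.eval b) ∧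
      ∀ ρ : V → Bool, Φ.matrix.eval ρ = true →
        ∃ t, IsFirst T (fun s => s.1.eval ρ = false) t ∧ ρ u = !t.2 := by
  obtain ⟨T, hsub, hdep, hsound⟩ := hD.1.exists_decisionList_take hu D.length le_rfl
  rw [List.take_length] at hsub hsound
  refine ⟨T, ?_, hdep, fun ρ hρ => ?_⟩
  · have := (hsub.map OBDD.size).sum_le_sum (by simp)
    rw [List.map_map] at this
    exact this
  · by_contra hcon
    push Not at hcon
    obtain ⟨B, hB, hB0⟩ := hD.2
    have h1 := hsound ρ hρ (fun t ht => by have := hcon t ht; simpa using this) B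
      (List.mem_of_getLast? hB)
    rw [hB0 ρ] at h1
    exact Bool.noConfusion h1

theorem two_le_derivationSize {Φ : PCNF V} {D : List (OBDD V π)} (hD : IsRefutation Φ D) :
    2 ≤ derivationSize D := by
  obtain ⟨B, hB, _⟩ := hD.2
  have h1 : B.size ≤ derivationSize D :=
    List.single_le_sum (by simp) _ (List.mem_map_of_mem (List.mem_of_getLast? hB))
  have h2 : B.size = B.inner + 2 := rfl
  omega

end Extraction

/-! ### Monochromatic rectangles of decision lists -/

section Rectangles

variable {α β : Type*}

open Classical in
-- A rectangle that is not large has a short side, and deleting that side from `A` or `B` costs less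
-- than `a / t` or `b / t` elements. The hypotheses provide one such unit for each rectangle, with
-- `m` units left over.
theorem exists_large_rectangle_or_avoid {κ : Type*} (s : Finset κ) (P : κ → α → Prop)
    (Q : κ → β → Prop) {t a b m : ℕ} {A : Finset α} {B : Finset β}
    (hA : (s.card + m) * a ≤ t * A.card) (hB : (s.card + m) * b ≤ t * B.card) :
    (∃ i ∈ s, a ≤ t * (A.filter (P i)).card ∧ b ≤ t * (B.filter (Q i)).card) ∨
      ∃ A' ⊆ A, ∃ B' ⊆ B, m * a ≤ t * A'.card ∧ m * b ≤ t * B'.card ∧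
        ∀ i ∈ s, ∀ x ∈ A', ∀ y ∈ B', ¬ (P i x ∧ Q i y) := by
  induction s using Finset.induction_on generalizing A B with
  | empty =>
    exact Or.inr ⟨A, subset_rfl, B, subset_rfl, by simpa using hA, by simpa using hB, by simp⟩
  | insert i s hi ih =>
    rw [Finset.card_insert_of_notMem hi] at hA hB
    by_cases h : a ≤ t * (A.filter (P i)).card ∧ b ≤ t * (B.filter (Q i)).card
    · exact Or.inl ⟨i, Finset.mem_insert_self _ _, h⟩
    have key : ∃ A₁ ⊆ A, ∃ B₁ ⊆ B, (s.card + m) * a ≤ t * A₁.card ∧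
        (s.card + m) * b ≤ t * B₁.card ∧ ∀ x ∈ A₁, ∀ y ∈ B₁, ¬ (P i x ∧ Q i y) := by
      rw [not_and_or, not_le, not_le] at h
      rcases h with h | h
      · refine ⟨A.filter (fun x => ¬ P i x), Finset.filter_subset _ _, B, subset_rfl, ?_, ?_, ?_⟩
        · have := Finset.card_filter_add_card_filter_not (s := A) (P i)
          rw [← this] at hA
          nlinarith
        · nlinarith
        · exact fun x hx y _ hxy => (Finset.mem_filter.mp hx).2 hxy.1
      · refine ⟨A, subset_rfl, B.filter (fun x => ¬ Q i x), Finset.filter_subset _ _, ?_, ?_, ?_⟩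
        · nlinarith
        · have := Finset.card_filter_add_card_filter_not (s := B) (Q i)
          rw [← this] at hB
          nlinarith
        · exact fun x _ y hy hxy => (Finset.mem_filter.mp hy).2 hxy.2
    obtain ⟨A₁, hA₁, B₁, hB₁, hcA, hcB, havoid⟩ := key
    rcases ih hcA hcB with ⟨j, hj, h1, h2⟩ | ⟨A', hA', B', hB', h1, h2, h3⟩
    · refine Or.inl ⟨j, Finset.mem_insert_of_mem hj, h1.trans ?_, h2.trans ?_⟩ <;> gcongr
    · refine Or.inr ⟨A', hA'.trans hA₁, B', hB'.trans hB₁, h1, h2, fun j hj x hx y hy => ?_⟩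
      rcases Finset.mem_insert.mp hj with rfl | hj
      · exact havoid x (hA' hx) y (hB' hy)
      · exact h3 j hj x hx y hy

/-- On a large rectangle of the first entry that entry decides, so the colour is constant. If there
is none, all its rectangles are peeled off and the rest of the list decides what remains. The extra
`1` keeps both sides nonempty when the list runs out, which is impossible since every point must hit
some entry. -/
theorem exists_monochromatic_rectangle {τ : Type*} {κ : τ → Type*} [∀ t, Fintype (κ t)]
    (P : ∀ t, κ t → α → Prop) (Q : ∀ t, κ t → β → Prop) (color : τ → Bool) (f : α → β → Bool)
    (T : List τ) {t a b : ℕ} (ha : 0 < a) (hb : 0 < b) {A : Finset α} {B : Finset β}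
    (hA : ((T.map (fun s => Fintype.card (κ s))).sum + 1) * a ≤ t * A.card)
    (hB : ((T.map (fun s => Fintype.card (κ s))).sum + 1) * b ≤ t * B.card)
    (hf : ∀ x ∈ A, ∀ y ∈ B,
      ∃ s, IsFirst T (fun s => ∃ q, P s q x ∧ Q s q y) s ∧ f x y = color s) :
    ∃ A' ⊆ A, ∃ B' ⊆ B, ∃ c, a ≤ t * A'.card ∧ b ≤ t * B'.card ∧
      ∀ x ∈ A', ∀ y ∈ B', f x y = c := by
  classical
  induction T generalizing A B with
  | nil =>
    exfalso
    obtain ⟨x, hx⟩ : A.Nonempty := by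
      rw [← Finset.card_pos]
      by_contra h
      simp_all
    obtain ⟨y, hy⟩ : B.Nonempty := by
      rw [← Finset.card_pos]
      by_contra h
      simp_all
    obtain ⟨s, ⟨l, r, hl, _⟩, _⟩ := hf x hx y hy
    simp at hl
  | cons s₀ T ih =>
    rw [List.map_cons, List.sum_cons, ← Finset.card_univ, add_assoc] at hA hB
    rcases exists_large_rectangle_or_avoid Finset.univ (P s₀) (Q s₀) hA hB with
      ⟨q, _, h1, h2⟩ | ⟨A₁, hA₁, B₁, hB₁, h1, h2, havoid⟩
    · refine ⟨_, Finset.filter_subset _ _, _, Finset.filter_subset _ _, color s₀, h1, h2, ?_⟩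
      intro x hx y hy
      rw [Finset.mem_filter] at hx hy
      obtain ⟨s, ⟨l, r, hl, _, hmin⟩, hcol⟩ := hf x hx.1 y hy.1
      cases l with
      | nil =>
        rw [List.nil_append, List.cons.injEq] at hl
        rw [hcol, hl.1]
      | cons s₁ l =>
        rw [List.cons_append, List.cons.injEq] at hl
        exact absurd ⟨q, hx.2, hy.2⟩ (hmin s₀ (hl.1 ▸ List.mem_cons_self))
    · obtain ⟨A', hA', B', hB', c, h3, h4, h5⟩ := ih h1 h2 (fun x hx y hy => by
        obtain ⟨s, ⟨l, r, hl, hs, hmin⟩, hcol⟩ := hf x (hA₁ hx) y (hB₁ hy)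
        cases l with
        | nil =>
          rw [List.nil_append, List.cons.injEq] at hl
          obtain ⟨q, hq⟩ := hs
          obtain ⟨rfl, _⟩ := hl
          exact absurd hq (havoid q (Finset.mem_univ _) x hx y hy)
        | cons s₁ l =>
          rw [List.cons_append, List.cons.injEq] at hl
          exact ⟨s, ⟨l, r, hl.2, hs, fun s' hs' => hmin s' (List.mem_cons_of_mem _ hs')⟩, hcol⟩)
      exact ⟨A', hA'.trans hA₁, B', hB'.trans hB₁, c, h3, h4, h5⟩

end Rectangles

/-! ### Monochromatic rectangles of the inner product function -/

section LinearAlgebra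

open Matrix

variable {I J : Type*} [Fintype I] [Fintype J]

/-- The image of `W` under `M` lies in the annihilator of `U`, of dimension `|I| - dim U`, and its
dimension is at least `dim W - dim ker M = dim W - (|J| - rank M)`. -/
theorem finrank_add_finrank_add_rank_le {K : Type*} [Field K] (M : Matrix I J K)
    (U : Submodule K (I → K)) (W : Submodule K (J → K))
    (h : ∀ u ∈ U, ∀ w ∈ W, u ⬝ᵥ M *ᵥ w = 0) :
    Module.finrank K U + Module.finrank K W + M.rank ≤ Fintype.card I + Fintype.card J := by
  classical
  set g : (J → K) →ₗ[K] Module.Dual K (I → K) :=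
    (dotProductEquiv K I).toLinearMap ∘ₗ M.mulVecLin with hg
  have hgapp : ∀ w u, g w u = u ⬝ᵥ M *ᵥ w := fun w u => dotProduct_comm _ _
  have hW := (g.domRestrict W).finrank_range_add_finrank_ker
  have h1 : Module.finrank K (g.domRestrict W).range ≤ Module.finrank K U.dualAnnihilator := by
    refine Submodule.finrank_mono ?_
    rintro _ ⟨w, rfl⟩
    rw [Submodule.mem_dualAnnihilator]
    intro u hu
    exact (hgapp w u).trans (h u hu w w.2)
  have h2 : Module.finrank K (g.domRestrict W).ker ≤ Module.finrank K M.mulVecLin.ker := by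
    rw [← Submodule.finrank_map_subtype_eq]
    refine Submodule.finrank_mono ?_
    rintro _ ⟨w, hw, rfl⟩
    have hw' : g w = 0 := hw
    rw [hg, LinearMap.comp_apply] at hw'
    exact (dotProductEquiv K I).map_eq_zero_iff.mp hw'
  have h3 := M.mulVecLin.finrank_range_add_finrank_ker
  have h4 := Subspace.finrank_add_finrank_dualAnnihilator_eq U
  have h5 : M.rank = Module.finrank K M.mulVecLin.range := rfl
  rw [Module.finrank_fintype_fun_eq_card] at h3 h4
  omega

theorem card_le_two_pow_finrank_span_sub [DecidableEq I] (A : Finset (I → ZMod 2)) (a : I → ZMod 2) :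
    A.card ≤ 2 ^ Module.finrank (ZMod 2)
      (Submodule.span (ZMod 2) (((A.image (· - a)) : Finset (I → ZMod 2)) : Set (I → ZMod 2))) := by
  set U := Submodule.span (ZMod 2) (((A.image (· - a)) : Finset (I → ZMod 2)) : Set (I → ZMod 2))
  have : Fintype U := Fintype.ofFinite U
  have hcard : Fintype.card U = 2 ^ Module.finrank (ZMod 2) U := by
    rw [Module.card_eq_pow_finrank (K := ZMod 2), ZMod.card]
  rw [← hcard, ← Finset.card_image_of_injective A (sub_left_injective (b := a)),
    ← Set.ncard_coe_finset, ← Nat.card_eq_fintype_card]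
  exact Set.ncard_le_ncard Submodule.subset_span (Set.toFinite _)

/-- By bilinearity orthogonality passes to the spans of the translates `A - a` and `B - b`, and a
span of dimension `k` over `ZMod 2` has `2^k` elements. -/
theorem card_mul_card_mul_two_pow_rank_le [DecidableEq I] [DecidableEq J] (M : Matrix I J (ZMod 2))
    {A : Finset (I → ZMod 2)} {B : Finset (J → ZMod 2)} (hA : A.Nonempty) (hB : B.Nonempty)
    (h : ∀ x ∈ A, ∀ x' ∈ A, ∀ y ∈ B, ∀ y' ∈ B, (x - x') ⬝ᵥ M *ᵥ (y - y') = 0) :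
    A.card * B.card * 2 ^ M.rank ≤ 2 ^ (Fintype.card I + Fintype.card J) := by
  obtain ⟨a, ha⟩ := hA
  obtain ⟨b, hb⟩ := hB
  have hA' := card_le_two_pow_finrank_span_sub A a
  have hB' := card_le_two_pow_finrank_span_sub B b
  set U := Submodule.span (ZMod 2) (((A.image (· - a)) : Finset (I → ZMod 2)) : Set (I → ZMod 2))
    with hU
  set W := Submodule.span (ZMod 2) (((B.image (· - b)) : Finset (J → ZMod 2)) : Set (J → ZMod 2))
    with hW
  have hUW : ∀ u ∈ U, ∀ w ∈ W, u ⬝ᵥ M *ᵥ w = 0 := by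
    intro u hu w hw
    induction hu using Submodule.span_induction with
    | zero => simp
    | add u u' _ _ h1 h2 => rw [add_dotProduct, h1, h2, add_zero]
    | smul c u _ h1 => rw [smul_dotProduct, h1, smul_zero]
    | mem u hu =>
      obtain ⟨x, hx, rfl⟩ := Finset.mem_image.mp (Finset.mem_coe.mp hu)
      induction hw using Submodule.span_induction with
      | zero => simp
      | add w w' _ _ h1 h2 => rw [mulVec_add, dotProduct_add, h1, h2, add_zero]
      | smul c w _ h1 => rw [mulVec_smul, dotProduct_smul, h1, smul_zero]
      | mem w hw =>
        obtain ⟨y, hy, rfl⟩ := Finset.mem_image.mp (Finset.mem_coe.mp hw)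
        exact h x hx a ha y hy b hb
  calc A.card * B.card * 2 ^ M.rank
      ≤ 2 ^ Module.finrank (ZMod 2) U * 2 ^ Module.finrank (ZMod 2) W * 2 ^ M.rank := by gcongr
    _ = 2 ^ (Module.finrank (ZMod 2) U + Module.finrank (ZMod 2) W + M.rank) := by
        rw [pow_add, pow_add]
    _ ≤ _ := Nat.pow_le_pow_right (by norm_num) (finrank_add_finrank_add_rank_le M U W hUW)

open Classical in
/-- If every column of `M` has at most `k` nonzero entries, then at most `k * M.rank` rows are
nonzero. -/
theorem card_le_mul_rank {K : Type*} [Field K] (M : Matrix I J K) {k : ℕ}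
    (hk : ∀ j, (Finset.univ.filter (fun i => M i j ≠ 0)).card ≤ k) {R : Finset I}
    (hR : ∀ i ∈ R, ∃ j, M i j ≠ 0) : R.card ≤ M.rank * k := by
  -- Let `b` be a basis of the column space chosen among the columns. A row vanishing on `b`
  -- vanishes on all columns, so the supports of the `M.rank` columns in `b` cover all nonzero rows.
  obtain ⟨b, hb, hspan, hli⟩ := exists_linearIndependent K (Set.range M.col)
  have : Fintype b := ((Set.finite_range M.col).subset hb).fintype
  have hrank : M.rank = b.toFinset.card := by
    rw [Matrix.rank_eq_finrank_span_cols, ← hspan, finrank_span_set_eq_card hli]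
  have hsub : R ⊆ b.toFinset.biUnion (fun c => Finset.univ.filter (fun i => c i ≠ 0)) := by
    intro i hi
    by_contra hcon
    simp only [Finset.mem_biUnion, Set.mem_toFinset, Finset.mem_filter, Finset.mem_univ, true_and,
      not_exists, not_and, not_not] at hcon
    obtain ⟨j, hj⟩ := hR i hi
    have hker : Submodule.span K b ≤ (LinearMap.proj i : (I → K) →ₗ[K] K).ker :=
      Submodule.span_le.mpr fun c hc => hcon c hc
    rw [hspan] at hker
    exact hj (hker (Submodule.subset_span ⟨j, rfl⟩))
  rw [hrank]
  refine (Finset.card_le_card hsub).trans (Finset.card_biUnion_le_card_mul _ _ _ fun c hc => ?_)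
  obtain ⟨j, rfl⟩ := hb (Set.mem_toFinset.mp hc)
  exact hk j

end LinearAlgebra

/-! ### The inner product function across a partition of the vertices -/

section Partition

open Matrix

variable {n : ℕ} (low : Fin n → Prop) [DecidablePred low]

theorem card_subtype_add_card_subtype_not :
    Fintype.card {i // low i} + Fintype.card {i // ¬ low i} = n := by
  rw [Fintype.card_subtype_compl, Fintype.card_fin]
  have := Fintype.card_subtype_le low
  rw [Fintype.card_fin] at this
  omega

/-- The assignment given by its restrictions to `low` and to the complement of `low`. -/
def combine (a : {i // low i} → ZMod 2) (b : {i // ¬ low i} → ZMod 2) (i : Fin n) : Bool :=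
  if h : low i then decide (a ⟨i, h⟩ = 1) else decide (b ⟨i, h⟩ = 1)

open Classical in
/-- The submatrix of the adjacency matrix with rows in `low` and columns outside of it. -/
noncomputable def crossMatrix (G : SimpleGraph (Fin n)) :
    Matrix {i // low i} {i // ¬ low i} (ZMod 2) :=
  (G.adjMatrix (ZMod 2)).submatrix Subtype.val Subtype.val

theorem sum_sum_extend_mul {N : Fin n → Fin n → ZMod 2} (a : {i // low i} → ZMod 2)
    (b : {i // ¬ low i} → ZMod 2) :
    ∑ u, ∑ v, N u v * ((if h : low u then a ⟨u, h⟩ else 0) * (if h : low v then 0 else b ⟨v, h⟩)) =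
      a ⬝ᵥ (Matrix.of N).submatrix Subtype.val Subtype.val *ᵥ b := by
  rw [← Fintype.sum_subtype_add_sum_subtype low]
  have h0 : ∑ u : {i // ¬ low i}, ∑ v, N u v * ((if h : low u then a ⟨u, h⟩ else 0) *
      (if h : low v then 0 else b ⟨v, h⟩)) = 0 :=
    Finset.sum_eq_zero fun u _ => Finset.sum_eq_zero fun v _ => by simp [u.2]
  rw [h0, add_zero, dotProduct]
  refine Finset.sum_congr rfl fun u _ => ?_
  rw [← Fintype.sum_subtype_add_sum_subtype low]
  have h1 : ∑ v : {i // low i}, N u v * ((if h : low u then a ⟨u, h⟩ else 0) *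
      (if h : low v then 0 else b ⟨v, h⟩)) = 0 :=
    Finset.sum_eq_zero fun v _ => by simp [v.2]
  rw [h1, zero_add, mulVec, dotProduct, Finset.mul_sum]
  refine Finset.sum_congr rfl fun v _ => ?_
  simp only [u.2, v.2, dif_pos, dif_neg, not_false_eq_true, submatrix_apply, of_apply]
  ring

theorem sum_edgeProduct_eq (G : SimpleGraph (Fin n)) [DecidableRel G.Adj] (x : Fin n → Bool) :
    ∑ e ∈ G.edgeFinset, edgeProduct x e = ∑ u, ∑ v, (if u < v ∧ G.Adj u v then (1 : ZMod 2) else 0) *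
      ((if x u then 1 else 0) * (if x v then 1 else 0)) := by
  have h1 : ∑ e ∈ G.edgeFinset, edgeProduct x e =
      ∑ e ∈ (Finset.univ : Finset (Fin n)).sym2 with ¬ e.IsDiag,
        if e ∈ G.edgeSet then edgeProduct x e else 0 := by
    rw [← Finset.sum_filter, Finset.filter_filter]
    refine Finset.sum_congr ?_ fun _ _ => rfl
    ext e
    simp only [SimpleGraph.mem_edgeFinset, Finset.sym2_univ, Finset.mem_filter, Finset.mem_univ,
      true_and]
    exact ⟨fun h => ⟨G.not_isDiag_of_mem_edgeSet h, h⟩, fun h => h.2⟩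
  rw [h1, Finset.sum_sym2_filter_not_isDiag, ← Fintype.sum_prod_type', Finset.sum_filter,
    ← Finset.sum_subset (Finset.subset_univ (Finset.univ : Finset (Fin n)).offDiag)]
  · refine Finset.sum_congr rfl fun p _ => ?_
    by_cases hlt : p.1 < p.2
    · by_cases hadj : G.Adj p.1 p.2
      · simp [hlt, hadj, edgeProduct]
      · simp [hadj]
    · simp [hlt]
  · intro p _ hp
    have : p.1 = p.2 := by simpa using hp
    simp [this]

/-- Edges inside either part contribute a function of that part alone; only the crossing edges
couple `a` and `b`, and they do so bilinearly. -/
theorem sum_edgeProduct_combine (G : SimpleGraph (Fin n)) [DecidableRel G.Adj] :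
    ∃ (q₁ : ({i // low i} → ZMod 2) → ZMod 2) (q₂ : ({i // ¬ low i} → ZMod 2) → ZMod 2),
      ∀ a b, ∑ e ∈ G.edgeFinset, edgeProduct (combine low a b) e =
        q₁ a + q₂ b + a ⬝ᵥ crossMatrix low G *ᵥ b := by
  set N : Fin n → Fin n → ZMod 2 := fun u v => if u < v ∧ G.Adj u v then 1 else 0 with hN
  set α : ({i // low i} → ZMod 2) → Fin n → ZMod 2 := fun a u => if h : low u then a ⟨u, h⟩ else 0
    with hα
  set β : ({i // ¬ low i} → ZMod 2) → Fin n → ZMod 2 :=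
    fun b u => if h : low u then 0 else b ⟨u, h⟩ with hβ
  refine ⟨fun a => ∑ u, ∑ v, N u v * (α a u * α a v), fun b => ∑ u, ∑ v, N u v * (β b u * β b v),
    fun a b => ?_⟩
  have hval : ∀ u, (if combine low a b u then (1 : ZMod 2) else 0) = α a u + β b u := by
    intro u
    have h2 : ∀ z : ZMod 2, (if decide (z = 1) = true then (1 : ZMod 2) else 0) = z := by decide
    by_cases h : low u
    · simp only [combine, hα, hβ, dif_pos h, h2, add_zero]
    · simp only [combine, hα, hβ, dif_neg h, h2, zero_add]
  -- `N` keeps one orientation of every edge, and a crossing edge may be oriented either way, so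
  -- both orientations are added.
  have hM : crossMatrix low G =
      (Matrix.of (fun u v => N u v + N v u)).submatrix Subtype.val Subtype.val := by
    ext i j
    have hij : i.val ≠ j.val := fun h => j.2 (h ▸ i.2)
    simp only [crossMatrix, submatrix_apply, SimpleGraph.adjMatrix_apply, of_apply, hN,
      G.adj_comm j.val i.val]
    rcases lt_or_gt_of_ne hij with h | h
    · simp [h, not_lt_of_gt h]
    · simp [h, not_lt_of_gt h]
  rw [sum_edgeProduct_eq, hM, ← sum_sum_extend_mul]
  simp only [hval, add_mul, mul_add, Finset.sum_add_distrib]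
  have hswap : ∑ u, ∑ v, N u v * (β b u * α a v) = ∑ u, ∑ v, N v u * (α a u * β b v) := by
    rw [Finset.sum_comm]
    refine Finset.sum_congr rfl fun u _ => Finset.sum_congr rfl fun v _ => ?_
    ring
  simp only [hN] at hswap ⊢
  linear_combination hswap

theorem card_mul_card_mul_two_pow_rank_crossMatrix_le (G : SimpleGraph (Fin n))
    {A : Finset ({i // low i} → ZMod 2)} {B : Finset ({i // ¬ low i} → ZMod 2)}
    (hA : A.Nonempty) (hB : B.Nonempty) {c : Bool}
    (h : ∀ a ∈ A, ∀ b ∈ B, innerProduct G (combine low a b) = c) :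
    A.card * B.card * 2 ^ (crossMatrix low G).rank ≤ 2 ^ n := by
  classical
  obtain ⟨q₁, q₂, hq⟩ := sum_edgeProduct_combine low G
  refine (card_mul_card_mul_two_pow_rank_le _ hA hB ?_).trans_eq
    (by rw [card_subtype_add_card_subtype_not])
  intro x hx x' hx' y hy y' hy'
  have hconst : ∀ a ∈ A, ∀ b ∈ B,
      q₁ a + q₂ b + a ⬝ᵥ crossMatrix low G *ᵥ b = if c then 1 else 0 := by
    intro a ha b hb
    have h1 := h a ha b hb
    rw [innerProduct_eq, hq] at h1
    have h2 : ∀ z : ZMod 2, z = if decide (z = 1) = true then (1 : ZMod 2) else 0 := by decide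
    rw [← h1]
    exact h2 _
  -- The alternating sum over the four corners of the rectangle cancels `q₁`, `q₂` and the constant.
  simp only [sub_dotProduct, mulVec_sub, dotProduct_sub]
  linear_combination hconst x hx y hy - hconst x' hx' y hy - hconst x hx y' hy' +
    hconst x' hx' y' hy'

/-- Each vertex of the open neighbourhood gives a nonzero row of the transpose, while the degree
bounds the nonzero entries in each of its columns. -/
theorem openNeighborhood_ncard_le_rank_mul (G : SimpleGraph (Fin n)) {k : ℕ}
    (hk : ∀ v, (G.neighborSet v).ncard ≤ k) :
    (openNeighborhood G {i | low i}).ncard ≤ (crossMatrix low G).rank * k := by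
  classical
  rw [← Matrix.rank_transpose]
  set R : Finset {i // ¬ low i} := Finset.univ.filter (fun j => ∃ i, (crossMatrix low G)ᵀ j i ≠ 0)
    with hR
  refine le_trans ?_ (card_le_mul_rank (R := R) (crossMatrix low G)ᵀ (k := k) ?_ ?_)
  · have hsub : openNeighborhood G {i | low i} ⊆ ((R.image Subtype.val : Finset (Fin n)) :
        Set (Fin n)) := by
      rintro v ⟨hv, u, hu, huv⟩
      rw [Finset.mem_coe, Finset.mem_image]
      refine ⟨⟨v, hv⟩, ?_, rfl⟩
      rw [hR, Finset.mem_filter]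
      refine ⟨Finset.mem_univ _, ⟨u, hu⟩, ?_⟩
      simp [crossMatrix, huv]
    refine (Set.ncard_le_ncard hsub (Finset.finite_toSet _)).trans ?_
    rw [Set.ncard_coe_finset]
    exact Finset.card_image_le
  · intro i
    refine le_trans ?_ (hk i.val)
    rw [← Set.ncard_coe_finset, ← Set.ncard_image_of_injective _ Subtype.val_injective]
    refine Set.ncard_le_ncard ?_ (Set.toFinite _)
    rintro _ ⟨j, hj, rfl⟩
    simp only [Finset.coe_filter, Finset.mem_univ, true_and, Set.mem_ofPred_eq] at hj
    by_contra hcon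
    exact hj (by simpa [crossMatrix] using hcon)
  · intro j hj
    exact (Finset.mem_filter.mp hj).2

end Partition

/-! ### The lower bound -/

/-- Moving the cut by one position adds at most one element, so no cardinality is skipped. This
halves `X` although gate variables may be interleaved with it. -/
theorem exists_card_filter_lt_eq {n : ℕ} {g : Fin n → ℕ} (hg : Function.Injective g) {m : ℕ}
    (hm : m ≤ n) : ∃ p, (Finset.univ.filter (fun i => g i < p)).card = m := by
  induction m with
  | zero => exact ⟨0, by simp⟩
  | succ m ih =>
    classical
    set c : ℕ → ℕ := fun p => (Finset.univ.filter (fun i => g i < p)).card with hc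
    have hex : ∃ p, m + 1 ≤ c p := by
      refine ⟨Finset.univ.sup g + 1, ?_⟩
      have : Finset.univ.filter (fun i => g i < Finset.univ.sup g + 1) = Finset.univ :=
        Finset.filter_true_of_mem fun i _ => Nat.lt_succ_of_le (Finset.le_sup (Finset.mem_univ i))
      simp only [hc, this, Finset.card_univ, Fintype.card_fin]
      exact hm
    refine ⟨Nat.find hex, le_antisymm ?_ (Nat.find_spec hex)⟩
    cases hp : Nat.find hex with
    | zero => simp
    | succ p =>
      have hlt : c p < m + 1 := not_le.mp (Nat.find_min hex (hp ▸ Nat.lt_succ_self p))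
      have hsub : Finset.univ.filter (fun i => g i < p + 1) ⊆
          Finset.univ.filter (fun i => g i < p) ∪ Finset.univ.filter (fun i => g i = p) := by
        intro i
        simp only [Finset.mem_union, Finset.mem_filter, Finset.mem_univ, true_and]
        omega
      have hone : (Finset.univ.filter (fun i => g i = p)).card ≤ 1 :=
        Finset.card_le_one.mpr fun i hi j hj => hg
          ((Finset.mem_filter.mp hi).2.trans (Finset.mem_filter.mp hj).2.symm)
      have h1 := (Finset.card_le_card hsub).trans (Finset.card_union_le _ _)
      simp only [hc] at hlt
      omega

theorem two_pow_rank_le_of_isRefutation {n : ℕ} {G : SimpleGraph (Fin n)} {C : Circuit (Fin n)}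
    (huses : C.UsesInputs) (heval : ∀ x, C.eval x = !(innerProduct G x)) {π : VarOrder C.Var}
    {D : List (OBDD C.Var π)} (hD : IsRefutation (C.pcnf huses) D) (p : ℕ) :
    2 ^ (crossMatrix (fun i => (π (Sum.inl i)).val < p) G).rank ≤ (derivationSize D + 1) ^ 2 := by
  classical
  set low : Fin n → Prop := fun i => (π (Sum.inl i)).val < p with hlow
  obtain ⟨T, hTsize, hTdep, hT⟩ := hD.exists_decisionList (u := Sum.inr C.output)
    fun v hv => (C.isUniversal_pcnf_iff huses v).mp hv
  -- The entries of the list ignore the gate variables, so these may be fixed arbitrarily.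
  set ext : (Fin n → Bool) → C.Var → Bool := fun x => Sum.elim x (fun _ => false) with hext
  have hfirst : ∀ x, ∃ t, IsFirst T (fun s => s.1.eval (ext x) = false) t ∧
      innerProduct G x = t.2 := by
    intro x
    obtain ⟨t, ⟨l, r, hl, ht, hmin⟩, hval⟩ := hT (C.value x) ((C.tseitin_eval_iff _).mpr rfl)
    have hsame : ∀ s ∈ T, s.1.eval (C.value x) = s.1.eval (ext x) := fun s hs =>
      hTdep s hs _ _ fun v hv => by
        obtain ⟨i, rfl⟩ := (C.leftOf_output_pcnf_iff huses v).mp hv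
        rfl
    refine ⟨t, ⟨l, r, hl, ?_, fun s hs => ?_⟩, ?_⟩
    · exact (hsame t (by rw [hl]; simp)).symm.trans ht
    · exact fun h => hmin s hs ((hsame s (by rw [hl]; simp [hs])).trans h)
    · have h1 : C.eval x = !t.2 := hval
      rw [heval] at h1
      simpa using h1
  have hcut : ∀ (s : OBDD C.Var π × Bool) (a : {i // low i} → ZMod 2)
      (b : {i // ¬ low i} → ZMod 2), s.1.eval (ext (combine low a b)) = false ↔
        ∃ q : Fin s.1.inner ⊕ Bool, s.1.cutNode p (ext (combine low a 0)) = q ∧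
          s.1.evalFrom (ext (combine low 0 b)) q = false := by
    intro s a b
    have h := s.1.eval_eq_evalFrom_cutNode (p := p) (a := ext (combine low a 0))
      (b := ext (combine low 0 b)) (c := ext (combine low a b))
      (fun v hv => by
        rcases v with i | g
        · have hi : low i := hv
          simp [hext, combine, hi]
        · rfl)
      (fun v hv => by
        rcases v with i | g
        · have hi : ¬ low i := not_lt.mpr hv
          simp [hext, combine, hi]
        · rfl)
    rw [h]
    exact ⟨fun h => ⟨_, rfl, h⟩, fun ⟨q, hq, h⟩ => hq ▸ h⟩
  have hsum : (T.map (fun s => Fintype.card (Fin s.1.inner ⊕ Bool))).sum ≤ derivationSize D := by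
    refine le_of_eq_of_le (congrArg List.sum (List.map_congr_left fun s _ => ?_)) hTsize
    simp [OBDD.size]
  set S := derivationSize D
  -- With `t = S + 1` and `a`, `b` the sizes of the two full sides, the rectangle obtained has
  -- density at least `1 / (S + 1)` on each side.
  obtain ⟨A, -, B, -, c, hA, hB, hconst⟩ := exists_monochromatic_rectangle
    (κ := fun s : OBDD C.Var π × Bool => Fin s.1.inner ⊕ Bool)
    (fun s q (a : {i // low i} → ZMod 2) => s.1.cutNode p (ext (combine low a 0)) = q)
    (fun s q (b : {i // ¬ low i} → ZMod 2) => s.1.evalFrom (ext (combine low 0 b)) q = false)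
    Prod.snd (fun a b => innerProduct G (combine low a b)) T (t := S + 1)
    (a := 2 ^ Fintype.card {i // low i}) (b := 2 ^ Fintype.card {i // ¬ low i})
    (by positivity) (by positivity) (A := Finset.univ) (B := Finset.univ)
    (by
      rw [Finset.card_univ, Fintype.card_fun, ZMod.card]
      exact Nat.mul_le_mul_right _ (Nat.succ_le_succ hsum))
    (by
      rw [Finset.card_univ, Fintype.card_fun, ZMod.card]
      exact Nat.mul_le_mul_right _ (Nat.succ_le_succ hsum))
    (fun a _ b _ => by
      obtain ⟨t, ⟨l, r, hl, ht, hmin⟩, hval⟩ := hfirst (combine low a b)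
      exact ⟨t, ⟨l, r, hl, (hcut t a b).mp ht, fun s hs h => hmin s hs ((hcut s a b).mpr h)⟩, hval⟩)
  have hAne : A.Nonempty := by
    rw [← Finset.card_pos]
    have := Nat.two_pow_pos (Fintype.card {i // low i})
    exact Nat.pos_of_mul_pos_left (this.trans_le hA)
  have hBne : B.Nonempty := by
    rw [← Finset.card_pos]
    have := Nat.two_pow_pos (Fintype.card {i // ¬ low i})
    exact Nat.pos_of_mul_pos_left (this.trans_le hB)
  have hrect := card_mul_card_mul_two_pow_rank_crossMatrix_le low G hAne hBne hconst
  refine Nat.le_of_mul_le_mul_left (c := 2 ^ n) ?_ (by positivity)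
  calc 2 ^ n * 2 ^ (crossMatrix low G).rank
      = (2 ^ Fintype.card {i // low i} * 2 ^ Fintype.card {i // ¬ low i}) *
          2 ^ (crossMatrix low G).rank := by
        rw [← pow_add 2 (Fintype.card {i // low i}), card_subtype_add_card_subtype_not]
    _ ≤ (((S + 1) * A.card) * ((S + 1) * B.card)) * 2 ^ (crossMatrix low G).rank := by gcongr
    _ = (S + 1) ^ 2 * (A.card * B.card * 2 ^ (crossMatrix low G).rank) := by ring
    _ ≤ (S + 1) ^ 2 * 2 ^ n := Nat.mul_le_mul_left _ hrect
    _ = 2 ^ n * (S + 1) ^ 2 := mul_comm _ _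

theorem two_rpow_le_derivationSize {n : ℕ} (hn : 2 ≤ n) {G : SimpleGraph (Fin n)}
    (hdeg : ∀ v, (G.neighborSet v).ncard ≤ 40) (hexp : 1 / 2 ≤ expansion G) {C : Circuit (Fin n)}
    (huses : C.UsesInputs) (heval : ∀ x, C.eval x = !(innerProduct G x)) {π : VarOrder C.Var}
    {D : List (OBDD C.Var π)} (hD : IsRefutation (C.pcnf huses) D) :
    (2 : ℝ) ^ ((1 / 960 : ℝ) * n) ≤ derivationSize D := by
  obtain ⟨p, hp⟩ := exists_card_filter_lt_eq (g := fun i => (π (Sum.inl i)).val)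
    (fun i j hij => Sum.inl_injective (π.injective (Fin.val_injective hij))) (Nat.div_le_self n 2)
  have hbound := two_pow_rank_le_of_isRefutation huses heval hD p
  have hN := openNeighborhood_ncard_le_rank_mul (fun i => (π (Sum.inl i)).val < p) G hdeg
  set r := (crossMatrix (fun i => (π (Sum.inl i)).val < p) G).rank
  have hScard : ({i | (π (Sum.inl i)).val < p} : Set (Fin n)).ncard = n / 2 := by
    rw [← hp, ← Set.ncard_coe_finset]
    simp
  -- The neighbourhood has at least `(1/2) ⌊n/2⌋ ≥ n/6` vertices, and the degree bound 40 divides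
  -- this.
  have hr : (n : ℝ) / 240 ≤ r := by
    have h1 := expansion_mul_ncard_le G (S := {i | (π (Sum.inl i)).val < p}) (by
      rw [hScard, Fintype.card_fin]
      exact Nat.cast_div_le)
    rw [hScard] at h1
    have h2 : (n : ℝ) ≤ 3 * ((n / 2 : ℕ) : ℝ) := by exact_mod_cast (by omega : n ≤ 3 * (n / 2))
    have h3 : ((openNeighborhood G {i | (π (Sum.inl i)).val < p}).ncard : ℝ) ≤ r * 40 := by
      exact_mod_cast hN
    have h4 : (1 / 2 : ℝ) * ((n / 2 : ℕ) : ℝ) ≤ expansion G * ((n / 2 : ℕ) : ℝ) := by gcongr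
    linarith
  have hS := two_le_derivationSize hD
  set S := derivationSize D
  -- Since `S ≥ 2`, `S + 1 ≤ S²`. The fourth root of `2^(n/240)` is the source of `1/960`.
  have hS4 : 2 ^ r ≤ S ^ 4 := by
    refine hbound.trans ?_
    calc (S + 1) ^ 2 ≤ (S ^ 2) ^ 2 := Nat.pow_le_pow_left (by nlinarith) 2
      _ = S ^ 4 := by ring
  rw [← pow_le_pow_iff_left₀ (by positivity) (by positivity) (by norm_num : (4 : ℕ) ≠ 0)]
  calc ((2 : ℝ) ^ ((1 / 960 : ℝ) * n)) ^ 4 = (2 : ℝ) ^ ((n : ℝ) / 240) := by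
        rw [← Real.rpow_natCast, ← Real.rpow_mul (by norm_num)]
        congr 1
        push_cast
        ring
    _ ≤ (2 : ℝ) ^ (r : ℝ) := Real.rpow_le_rpow_of_exponent_le (by norm_num) hr
    _ = (2 : ℝ) ^ r := Real.rpow_natCast _ _
    _ ≤ (S : ℝ) ^ 4 := by exact_mod_cast hS4

theorem mainTheorem1 :
    ∃ (Δ : ℕ) (d : ℝ) (K : ℕ) (c : ℝ), 0 < d ∧ 0 < c ∧
      ∀ n : ℕ, 2 ≤ n →
        ∃ (G : SimpleGraph (Fin n)) (C : Circuit (Fin n)) (Φ : PCNF C.Var),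
          (∀ v, (G.neighborSet v).ncard ≤ Δ) ∧ d ≤ expansion G ∧
          (∀ x, C.eval x = !(innerProduct G x)) ∧ C.size ≤ K * n ∧
          Φ.quants = C.existsForallExists ∧ Φ.matrix = C.tseitin ∧
          Φ.IsFalse ∧
          Φ.size ≤ K * n ∧
          ∀ (π : VarOrder C.Var) (D : List (OBDD C.Var π)),
            IsRefutation Φ D → (2 : ℝ) ^ (c * (n : ℝ)) ≤ (derivationSize D : ℝ) := by
  -- For `K`: the circuit has at most `101n + 2` gates and the formula size is at most `n + 1 +
  -- 11(101n + 2)`, which is below `1200n` for `n ≥ 2`.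
  refine ⟨40, 1 / 2, 1200, 1 / 960, by norm_num, by norm_num, fun n hn => ?_⟩
  obtain ⟨G, hdeg, hexp⟩ := exists_expander n hn
  obtain ⟨C, hsize, huses, heval⟩ :=
    exists_circuit_not_innerProduct (k := 20) (by omega : 0 < n) G hdeg
  have hΦ := C.size_pcnf_le huses
  exact ⟨G, C, C.pcnf huses, hdeg, hexp, heval, by omega, rfl, rfl, C.isFalse_pcnf huses, by omega,
    fun π D hD => two_rpow_le_derivationSize hn hdeg hexp huses heval hD⟩
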